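/- **Setting.** Fix a rank $r\ge 1$ and constants $L>0$, $\sigma$, $K\ge 0$, $c>0$, $\alpha<1$, $\delta>0$, and let $p\in(0,1]$. Consider a sequence of models with dimensions $r<d\le n\le e^{d^{\alpha}}$, $n\to\infty$ (the index of the sequence is suppressed). In each of them $M_0=U\,\mathrm{diag}(\lambda_1,\dots,\lambda_r)V^T\in\mathbb R^{n\times d}$ is a singular value decomposition with $U\in\mathbb R^{n\times r}$, $V\in\mathbb R^{d\times r}$ having orthonormal columns and $\lambda_1\ge\dots\ge\lambda_r>0$, and the entries of $M_0$ are bounded by $L$ in absolute value. The noise $\epsilon\in\mathbb R^{n\times d}$ has i.i.d. sub-Gaussian entries with mean $0$, variance $\sigma^2$ and variance proxy $K$; the entries of $y\in\{0,1\}^{n\times d}$ are i.i.d. Bernoulli($p$), independent of $\epsilon$. One observes $y$ and $M=y\cdot(M_0+\epsilon)$ (entrywise product). **Estimator.** Let $\hat p=\frac1{nd}\sum_{k,h}y_{kh}$, $\hat\Sigma=M^TM-(1-\hat p)\,\mathrm{diag}(M^TM)$ and $\hat\Sigma_t=MM^T-(1-\hat p)\,\mathrm{diag}(MM^T)$. Let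 $\hat V_1,\dots,\hat V_d$ and $\hat U_1,\dots,\hat U_n$ be orthonormal eigenvectors of $\hat\Sigma$ and $\hat\Sigma_t$, ordered by decreasing eigenvalue (any choice), let $\hat\ell_1\ge\dots\ge\hat\ell_d$ be the eigenvalues of $\hat\Sigma$, and put $$\hat\tau=\frac1{d-r}\,\mathrm{tr}\big(\hat V_c^T\hat\Sigma\hat V_c\big),\quad \hat V_c=(\hat V_{r+1},\dots,\hat V_d),\qquad \hat\lambda_i=\sqrt{\hat p^{-2}(\hat\ell_i-\hat\tau)}\quad(1\le i\le r).$$ For $s\in\{-1,1\}^r$ let $\hat M(s)=\sum_{i=1}^r s_i\hat\lambda_i\hat U_i\hat V_i^T$. Let $\hat s$ be any minimizer over $s\in\{-1,1\}^r$ of $Q(s)=\sum_{(k,h):\,y_{kh}=1}\big(\hat M(s)_{kh}-M_{kh}\big)^2$, and let $s_{0i}=\mathrm{sign}\langle\hat V_i,V_i\rangle\,\mathrm{sign}\langle\hat U_i,U_i\rangle$. **Assumptions.** 1. $\lambda_i=b_i\sqrt{nd}$ with $1/c\le b_i\le c$ for $i=1,\dots,r$ (the $b_i$ may vary along the sequence).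 2. (i) $\mathbb P\big(\min_{s\in\{-1,1\}^r}Q(s)<Q(s_0)\big)\to0$. (ii) The $b_i$ are strictly decreasing with gaps that do not vanish: $b_i-b_{i'}\ge\delta$ for all $1\le i<i'\le r$ (when the $b_i$ are constants, this is just $b_1>\dots>b_r$). **Theorem.** For every $\eta>0$ there is a constant $C_\eta>0$, depending only on $\eta,r,L,\sigma,K,c,\alpha,\delta$ (in particular not on $n$, $d$, $p$), such that for all sufficiently large indices of the sequence $$\mathbb P\Big(\frac{p\,b_r^4}{n}\,\big\|\hat M(\hat s)-M_0\big\|_F^2\ge C_\eta\Big)\le\eta .$$ Alternatively, for every real sequence $h\to\infty$, $\ \|\hat M(\hat s)-M_0\|_F^2=\frac{1}{p\,b_r^4}\,o_p(h\,n)$, that is, $\mathbb P\big(\frac{p\,b_r^4}{h\,n}\|\hat M(\hat s)-M_0\|_F^2\ge\xi\big)\to0$ for every $\xi>0$. -/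

import Mathlib

open MeasureTheory ProbabilityTheory Filter Topology
open scoped NNReal ENNReal Matrix

universe u

noncomputable section

namespace MatrixCompletion

/-- Squared Frobenius norm of a real matrix. -/
def frobSq {n d : ℕ} (A : Matrix (Fin n) (Fin d) ℝ) : ℝ :=
  ∑ k, ∑ h, A k h ^ 2

/-- The sign of a real number, as an element of `{-1, 1}` (with value `1` at `0`). -/
def sgn (x : ℝ) : ℤˣ := if 0 ≤ x then 1 else -1

/-- Entrywise product `y · A`; when `y` has entries in `{0, 1}` this is the projection of `A` onto
the set of observed entries (the entries where `y` equals `1`). -/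
def mask {n d : ℕ} (y A : Matrix (Fin n) (Fin d) ℝ) : Matrix (Fin n) (Fin d) ℝ :=
  Matrix.of fun k h => y k h * A k h

/-- The proportion of observed entries. -/
def pHat {n d : ℕ} (y : Matrix (Fin n) (Fin d) ℝ) : ℝ :=
  (∑ k, ∑ h, y k h) / ((n : ℝ) * (d : ℝ))

/-- `Mᵀ M - (1 - q) diag(Mᵀ M)`. -/
def adjGram {n d : ℕ} (q : ℝ) (M : Matrix (Fin n) (Fin d) ℝ) : Matrix (Fin d) (Fin d) ℝ :=
  Mᵀ * M - (1 - q) • Matrix.diagonal (Matrix.diag (Mᵀ * M))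

/-- `A = Q diag(ev) Qᵀ` is an eigendecomposition of `A` with `Q` orthogonal and the eigenvalues
`ev` listed in decreasing order (with multiplicity). -/
structure IsEigendecomp {m : ℕ} (A Q : Matrix (Fin m) (Fin m) ℝ) (ev : Fin m → ℝ) : Prop where
  orthogonal : Qᵀ * Q = 1
  antitone : Antitone ev
  eq_mul : A = Q * Matrix.diagonal ev * Qᵀ

/-- The last `m - r` columns of a square matrix. -/
def tailCols {m : ℕ} (r : ℕ) (Q : Matrix (Fin m) (Fin m) ℝ) :
    Matrix (Fin m) {j : Fin m // r ≤ j.val} ℝ :=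
  Q.submatrix id Subtype.val

/-- The model at one size `(n, d)`: a rank `r` matrix `M₀ = U diag(lam) Vᵀ` (singular value
decomposition) with entries bounded by `L`, corrupted by i.i.d. centred noise `ε` of variance `σ²`
that is sub-Gaussian with variance proxy `K`, each entry being observed independently with
probability `p`, independently of the noise. -/
structure Model (r : ℕ) (p σ L : ℝ) (K : ℝ≥0) where
  n : ℕ
  d : ℕ
  r_lt_d : r < d
  d_le_n : d ≤ n
  /-- left singular vectors (columns) -/
  U : Matrix (Fin n) (Fin r) ℝ
  /-- right singular vectors (columns) -/
  V : Matrix (Fin d) (Fin r) ℝ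
  /-- singular values -/
  lam : Fin r → ℝ
  U_orth : Uᵀ * U = 1
  V_orth : Vᵀ * V = 1
  lam_antitone : Antitone lam
  lam_pos : ∀ i, 0 < lam i
  bounded : ∀ k h, |(U * Matrix.diagonal lam * Vᵀ) k h| ≤ L
  Ω : Type u
  mΩ : MeasurableSpace Ω
  μ : Measure Ω
  isProb : IsProbabilityMeasure μ
  /-- noise -/
  ε : Ω → Matrix (Fin n) (Fin d) ℝ
  /-- observation indicators -/
  y : Ω → Matrix (Fin n) (Fin d) ℝ
  ε_meas : ∀ k h, Measurable fun ω => ε ω k h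
  y_meas : ∀ k h, Measurable fun ω => y ω k h
  ε_indep : iIndepFun (fun (kh : Fin n × Fin d) ω => ε ω kh.1 kh.2) μ
  ε_ident : ∀ k h k' h', IdentDistrib (fun ω => ε ω k h) (fun ω => ε ω k' h') μ μ
  ε_mean : ∀ k h, ∫ ω, ε ω k h ∂μ = 0
  ε_var : ∀ k h, variance (fun ω => ε ω k h) μ = σ ^ 2
  ε_subG : ∀ k h, HasSubgaussianMGF (fun ω => ε ω k h) K μ
  y_zero_or_one : ∀ ω k h, y ω k h = 0 ∨ y ω k h = 1
  y_indep : iIndepFun (fun (kh : Fin n × Fin d) ω => y ω kh.1 kh.2) μ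
  y_bernoulli : ∀ k h, μ {ω | y ω k h = 1} = ENNReal.ofReal p
  y_indep_ε : IndepFun (fun ω (kh : Fin n × Fin d) => y ω kh.1 kh.2)
    (fun ω (kh : Fin n × Fin d) => ε ω kh.1 kh.2) μ

namespace Model

variable {r : ℕ} {p σ L : ℝ} {K : ℝ≥0} (S : Model.{u} r p σ L K)

/-- The underlying matrix `M₀`. -/
def M₀ : Matrix (Fin S.n) (Fin S.d) ℝ := S.U * Matrix.diagonal S.lam * S.Vᵀ

/-- The partially observed matrix `M = y · (M₀ + ε)`. -/
def M (ω : S.Ω) : Matrix (Fin S.n) (Fin S.d) ℝ := mask (S.y ω) (S.M₀ + S.ε ω)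

/-- The normalised singular values: `lam i = b i * √(n d)`. -/
def b (i : Fin r) : ℝ := S.lam i / √((S.n : ℝ) * (S.d : ℝ))

/-- The adjusted Gram matrix `MᵀM - (1 - p̂) diag(MᵀM)`. -/
def sigmaHat (ω : S.Ω) : Matrix (Fin S.d) (Fin S.d) ℝ := adjGram (pHat (S.y ω)) (S.M ω)

/-- The adjusted Gram matrix `MMᵀ - (1 - p̂) diag(MMᵀ)`. -/
def sigmaHatT (ω : S.Ω) : Matrix (Fin S.n) (Fin S.n) ℝ := adjGram (pHat (S.y ω)) (S.M ω)ᵀ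

/-- `1/c ≤ b_i ≤ c` for all `i`, and `n ≤ exp(d ^ α)`. -/
structure Regular (c α : ℝ) : Prop where
  b_lower : ∀ i, 1 / c ≤ S.b i
  b_upper : ∀ i, S.b i ≤ c
  n_le : (S.n : ℝ) ≤ Real.exp ((S.d : ℝ) ^ α)

end Model

/-- A choice, for every outcome, of eigendecompositions of the two adjusted Gram matrices.
Eigenvectors are only determined up to sign (and up to rotation if eigenvalues coincide); any
choice is allowed. -/
structure Spectral {r : ℕ} {p σ L : ℝ} {K : ℝ≥0} (S : Model.{u} r p σ L K) where
  VFull : S.Ω → Matrix (Fin S.d) (Fin S.d) ℝ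
  evV : S.Ω → Fin S.d → ℝ
  UFull : S.Ω → Matrix (Fin S.n) (Fin S.n) ℝ
  evU : S.Ω → Fin S.n → ℝ
  decompV : ∀ ω, IsEigendecomp (S.sigmaHat ω) (VFull ω) (evV ω)
  decompU : ∀ ω, IsEigendecomp (S.sigmaHatT ω) (UFull ω) (evU ω)

namespace Spectral

variable {r : ℕ} {p σ L : ℝ} {K : ℝ≥0} {S : Model.{u} r p σ L K} (E : Spectral S)

/-- The `i`-th estimated right singular vector. -/
def vHat (ω : S.Ω) (i : Fin r) : Fin S.d → ℝ :=
  fun h => E.VFull ω h (Fin.castLE S.r_lt_d.le i)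

/-- The `i`-th estimated left singular vector. -/
def uHat (ω : S.Ω) (i : Fin r) : Fin S.n → ℝ :=
  fun k => E.UFull ω k (Fin.castLE (S.r_lt_d.le.trans S.d_le_n) i)

/-- `τ̂ = tr(V_cᵀ Σ̂ V_c) / (d - r)`, with `V_c` the last `d - r` eigenvectors. -/
def tauHat (ω : S.Ω) : ℝ :=
  ((tailCols r (E.VFull ω))ᵀ * S.sigmaHat ω * tailCols r (E.VFull ω)).trace /
    ((S.d : ℝ) - (r : ℝ))

/-- The `i`-th estimated singular value. -/
def lamHat (ω : S.Ω) (i : Fin r) : ℝ :=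
  √((E.evV ω (Fin.castLE S.r_lt_d.le i) - E.tauHat ω) / pHat (S.y ω) ^ 2)

/-- `M̂(s) = ∑ i, s_i λ̂_i Û_i V̂_iᵀ`. -/
def MHat (ω : S.Ω) (s : Fin r → ℤˣ) : Matrix (Fin S.n) (Fin S.d) ℝ :=
  ∑ i, (((s i : ℤ) : ℝ) * E.lamHat ω i) • Matrix.vecMulVec (E.uHat ω i) (E.vHat ω i)

/-- The true signs `s₀`. -/
def s₀ (ω : S.Ω) (i : Fin r) : ℤˣ :=
  sgn (E.vHat ω i ⬝ᵥ fun h => S.V h i) * sgn (E.uHat ω i ⬝ᵥ fun k => S.U k i)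

/-- `‖P_Ω(M̂(s)) - P_Ω(M)‖_F²`. -/
def obj (ω : S.Ω) (s : Fin r → ℤˣ) : ℝ :=
  frobSq (mask (S.y ω) (E.MHat ω s) - mask (S.y ω) (S.M ω))

/-- `ŝ` minimises the observed squared error over all sign vectors, for every outcome (ties may be
broken arbitrarily). -/
def IsSignEstimator (sHat : S.Ω → Fin r → ℤˣ) : Prop :=
  ∀ ω s, E.obj ω (sHat ω) ≤ E.obj ω s

/-- The event that the minimum of the observed squared error over all sign vectors is strictly
smaller than its value at the true signs. -/
def signFailure : Set S.Ω := {ω | ∃ s, E.obj ω s < E.obj ω (E.s₀ ω)}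

/-- The squared Frobenius error `‖M̂(ŝ) - M₀‖_F²`. -/
def sqError (sHat : S.Ω → Fin r → ℤˣ) (ω : S.Ω) : ℝ :=
  frobSq (E.MHat ω (sHat ω) - S.M₀)

end Spectral

/-- The asymptotic setting: models indexed by `j`, with the dimension `n` tending to infinity,
normalised singular values bounded and bounded away from zero, `d ≤ n ≤ exp(d ^ α)`, normalised
singular values strictly separated (by a gap `δ` that does not depend on `j`), and the sign
selection condition; together with a sign estimator for each model. -/
structure Setting {r : ℕ} {p σ L : ℝ} {K : ℝ≥0} (c α δ : ℝ) (S : ℕ → Model.{u} r p σ L K)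
    (E : ∀ j, Spectral (S j)) (sHat : ∀ j, (S j).Ω → Fin r → ℤˣ) : Prop where
  n_tendsto : Tendsto (fun j => (S j).n) atTop atTop
  regular : ∀ j, (S j).Regular c α
  gap : ∀ j (i i' : Fin r), i < i' → δ ≤ (S j).b i - (S j).b i'
  sign_condition : Tendsto (fun j => (S j).μ (E j).signFailure) atTop (𝓝 0)
  sHat_spec : ∀ j, (E j).IsSignEstimator (sHat j)

end MatrixCompletion

end

/-!
The error bound rests on a perturbation argument around `M = p M₀ + N`, where `N = M - p M₀` has
independent centred entries of variance at most `p (L² + σ²)`. Substituting into the adjusted Gram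
matrix `Σ̂` gives `p² M₀ᵀM₀`, the cross terms `p (M₀ᵀN + NᵀM₀)`, the quadratic term `NᵀN` and the
diagonal correction (`norm_adjGram_sub_le`).

* The cross terms only see the noise through `UᵀN`, which has `r d` entries of variance of order
  `p`; a second moment bound makes them of order `p^(3/2) n √d`, with a constant free of `p`.
* The quadratic term is at most `‖N‖²`. A union bound over an integer grid
  (`measure_opNorm_gt_le`) shows that `‖N‖²` is of order `n`, with a constant that depends on `p`;
  since `p` is fixed and `d → ∞`, this is below `p^(3/2) n √d`. The diagonal correction is at most
  of the order of `n L² + ‖N‖²` and is negligible for the same reason.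

So `Σ̂` differs from `p² M₀ᵀM₀` by `O(p^(3/2) n √d)`, and the same holds for `MMᵀ`, while the nonzero
eigenvalues `p² λ_i²` of the unperturbed matrices are separated from each other and from `0` by a
multiple of `p² n d`. Weyl's inequality (`IsEigendecomp.ev_le`, `IsEigendecomp.le_ev`) yields
`|λ̂_i - λ_i| = O(√(n / p))` (`Spectral.abs_lamHat_sub_le`), and the Davis–Kahan bound
(`IsEigendecomp.dist_sq_le`) yields errors of order `1 / √(p d)` for the singular vectors. Since
`λ_i` is of order `√(n d)`, these combine, for every sign vector `s`, to a squared Frobenius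
distance `O(n / p)` between `M̂(s)` and `M₀` with its singular values multiplied by `s * s₀`
(`Spectral.frobSq_MHat_sub_le`).

It remains to see that every minimiser `ŝ` equals `s₀`
(`Spectral.eq_s₀_of_isSignEstimator`). Changing the signs of some singular values moves `M₀` by a
matrix with bounded entries and squared Frobenius norm at least a multiple of `n d`; by Chebyshev's
inequality a proportion of about `p` of that is observed, and this outweighs the estimation error
of order `n / p`. The argument excludes ties as well, in which several sign vectors minimise the
observed error.

All random inputs are collected in `Model.GoodOutcome`, which has probability close to one as soon
as `d` is large (`Model.exists_eventually_measure_not_goodOutcome_le`); the rest is deterministic.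
The condition `n ≤ exp (d ^ α)` enters through `d → ∞` (`Setting.tendsto_d`). The second
half of the theorem follows from the first.
-/

namespace MatrixCompletion

section LinearAlgebra

open scoped Matrix.Norms.L2Operator

variable {m n r : ℕ}

/-! ### Spectral norm and Frobenius norm -/

lemma dotProduct_self_eq_norm_sq (x : Fin m → ℝ) : x ⬝ᵥ x = ‖WithLp.toLp 2 x‖ ^ 2 := by
  rw [EuclideanSpace.norm_sq_eq]
  simp [dotProduct, sq]

lemma sqrt_dotProduct_self (x : Fin m → ℝ) : √(x ⬝ᵥ x) = ‖WithLp.toLp 2 x‖ := by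
  rw [dotProduct_self_eq_norm_sq, Real.sqrt_sq (norm_nonneg _)]

lemma dotProduct_self_nonneg_real (x : Fin m → ℝ) : 0 ≤ x ⬝ᵥ x := by
  rw [dotProduct_self_eq_norm_sq]; positivity

lemma abs_dotProduct_le (x y : Fin m → ℝ) : |x ⬝ᵥ y| ≤ √(x ⬝ᵥ x) * √(y ⬝ᵥ y) := by
  rw [sqrt_dotProduct_self, sqrt_dotProduct_self]
  have := abs_real_inner_le_norm (WithLp.toLp 2 y) (WithLp.toLp 2 x)
  rw [EuclideanSpace.inner_eq_star_dotProduct] at this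
  simpa [mul_comm] using this

lemma norm_toLp_mulVec_le (A : Matrix (Fin m) (Fin n) ℝ) (x : Fin n → ℝ) :
    ‖WithLp.toLp 2 (A *ᵥ x)‖ ≤ ‖A‖ * ‖WithLp.toLp 2 x‖ :=
  Matrix.l2_opNorm_mulVec A (WithLp.toLp 2 x)

lemma mulVec_dotProduct_self_le (A : Matrix (Fin m) (Fin n) ℝ) (x : Fin n → ℝ) :
    (A *ᵥ x) ⬝ᵥ (A *ᵥ x) ≤ ‖A‖ ^ 2 * (x ⬝ᵥ x) := by
  rw [dotProduct_self_eq_norm_sq, dotProduct_self_eq_norm_sq, ← mul_pow]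
  exact pow_le_pow_left₀ (norm_nonneg _) (norm_toLp_mulVec_le A x) 2

lemma abs_dotProduct_mulVec_le (A : Matrix (Fin m) (Fin n) ℝ) (x : Fin m → ℝ) (y : Fin n → ℝ) :
    |x ⬝ᵥ A *ᵥ y| ≤ ‖A‖ * (√(x ⬝ᵥ x) * √(y ⬝ᵥ y)) := by
  refine (abs_dotProduct_le _ _).trans ?_
  rw [sqrt_dotProduct_self (A *ᵥ y), sqrt_dotProduct_self y, mul_left_comm]
  exact mul_le_mul_of_nonneg_left (norm_toLp_mulVec_le A y) (Real.sqrt_nonneg _)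

lemma opNorm_le_of_mulVec_le (A : Matrix (Fin m) (Fin n) ℝ) {e : ℝ} (he : 0 ≤ e)
    (h : ∀ x, ‖WithLp.toLp 2 (A *ᵥ x)‖ ≤ e * ‖WithLp.toLp 2 x‖) : ‖A‖ ≤ e := by
  rw [Matrix.l2_opNorm_def]
  exact ContinuousLinearMap.opNorm_le_bound _ he fun x => h x.ofLp

lemma opNorm_le_of_dotProduct_le (A : Matrix (Fin m) (Fin n) ℝ) {e : ℝ} (he : 0 ≤ e)
    (h : ∀ x y, x ⬝ᵥ A *ᵥ y ≤ e * (√(x ⬝ᵥ x) * √(y ⬝ᵥ y))) : ‖A‖ ≤ e := by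
  refine opNorm_le_of_mulVec_le A he fun x => ?_
  have := h (A *ᵥ x) x
  rw [dotProduct_self_eq_norm_sq, ← dotProduct_self_eq_norm_sq, sqrt_dotProduct_self,
    sqrt_dotProduct_self, dotProduct_self_eq_norm_sq] at this
  rcases (norm_nonneg (WithLp.toLp 2 (A *ᵥ x))).eq_or_lt with h0 | h0
  · rw [← h0]; positivity
  · nlinarith

lemma frobSq_nonneg (A : Matrix (Fin m) (Fin n) ℝ) : 0 ≤ frobSq A :=
  Finset.sum_nonneg fun _ _ => Finset.sum_nonneg fun _ _ => sq_nonneg _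

lemma opNorm_le_sqrt_frobSq (A : Matrix (Fin m) (Fin n) ℝ) : ‖A‖ ≤ √(frobSq A) := by
  refine opNorm_le_of_mulVec_le A (Real.sqrt_nonneg _) fun x => ?_
  refine le_of_sq_le_sq ?_ (by positivity)
  rw [mul_pow, Real.sq_sqrt (frobSq_nonneg A), ← dotProduct_self_eq_norm_sq,
    ← dotProduct_self_eq_norm_sq, frobSq, Finset.sum_mul]
  refine Finset.sum_le_sum fun k _ => ?_
  rw [← sq]
  have := Finset.sum_mul_sq_le_sq_mul_sq Finset.univ (fun h => A k h) x
  simpa [Matrix.mulVec, dotProduct, sq] using this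

lemma opNorm_transpose (A : Matrix (Fin m) (Fin n) ℝ) : ‖Aᵀ‖ = ‖A‖ := by
  rw [← Matrix.conjTranspose_eq_transpose_of_trivial, Matrix.l2_opNorm_conjTranspose]

lemma opNorm_transpose_mul_self (A : Matrix (Fin m) (Fin n) ℝ) : ‖Aᵀ * A‖ = ‖A‖ ^ 2 := by
  rw [← Matrix.conjTranspose_eq_transpose_of_trivial, Matrix.l2_opNorm_conjTranspose_mul_self, sq]

lemma opNorm_le_one_of_orth {W : Matrix (Fin m) (Fin n) ℝ} (hW : Wᵀ * W = 1) : ‖W‖ ≤ 1 := by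
  refine opNorm_le_of_mulVec_le W zero_le_one fun x => ?_
  rw [one_mul, ← sqrt_dotProduct_self, ← sqrt_dotProduct_self, Matrix.dotProduct_mulVec,
    ← Matrix.mulVec_transpose, Matrix.mulVec_mulVec, hW, Matrix.one_mulVec]

lemma opNorm_diagonal_le {v : Fin m → ℝ} {b : ℝ} (hb : 0 ≤ b) (h : ∀ i, |v i| ≤ b) :
    ‖Matrix.diagonal v‖ ≤ b := by
  rw [Matrix.l2_opNorm_diagonal]
  exact (pi_norm_le_iff_of_nonneg hb).2 h

/-- The squared column norms of a matrix are bounded by its squared spectral norm. -/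
lemma sum_sq_col_le (A : Matrix (Fin m) (Fin n) ℝ) (h : Fin n) : ∑ k, A k h ^ 2 ≤ ‖A‖ ^ 2 := by
  have := mulVec_dotProduct_self_le A (Pi.single h 1)
  simpa [dotProduct, sq, Pi.single_apply] using this

lemma frobSq_transpose (A : Matrix (Fin m) (Fin n) ℝ) : frobSq Aᵀ = frobSq A := by
  simp only [frobSq, Matrix.transpose_apply]; exact Finset.sum_comm

lemma frobSq_vecMulVec (u : Fin m → ℝ) (v : Fin n → ℝ) :
    frobSq (Matrix.vecMulVec u v) = (u ⬝ᵥ u) * (v ⬝ᵥ v) := by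
  simp [frobSq, Matrix.vecMulVec_apply, dotProduct, Finset.sum_mul_sum, sq, mul_mul_mul_comm]

lemma frobSq_smul (a : ℝ) (A : Matrix (Fin m) (Fin n) ℝ) : frobSq (a • A) = a ^ 2 * frobSq A := by
  simp [frobSq, mul_pow, Finset.mul_sum]

lemma frobSq_sum_le {ι : Type*} [Fintype ι] (A : ι → Matrix (Fin m) (Fin n) ℝ) :
    frobSq (∑ i, A i) ≤ Fintype.card ι * ∑ i, frobSq (A i) := by
  have h1 : ∀ k h, (∑ i, A i) k h ^ 2 ≤ Fintype.card ι * ∑ i, A i k h ^ 2 := fun k h => by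
    rw [Matrix.sum_apply]
    simpa using sq_sum_le_card_mul_sum_sq (s := Finset.univ) (f := fun i => A i k h)
  calc frobSq (∑ i, A i) ≤ ∑ k, ∑ h, Fintype.card ι * ∑ i, A i k h ^ 2 :=
        Finset.sum_le_sum fun k _ => Finset.sum_le_sum fun h _ => h1 k h
    _ = Fintype.card ι * ∑ i, frobSq (A i) := by
        simp only [frobSq, ← Finset.mul_sum]
        rw [Finset.sum_comm (s := Finset.univ (α := ι))]
        exact congrArg _ (Finset.sum_congr rfl fun k _ => Finset.sum_comm)

lemma frobSq_add₃_le (A B C : Matrix (Fin m) (Fin n) ℝ) :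
    frobSq (A + B + C) ≤ 3 * (frobSq A + frobSq B + frobSq C) := by
  simp only [frobSq, ← Finset.sum_add_distrib, Finset.mul_sum]
  refine Finset.sum_le_sum fun k _ => Finset.sum_le_sum fun h _ => ?_
  simp only [Matrix.add_apply]
  nlinarith [sq_nonneg (A k h - B k h), sq_nonneg (A k h - C k h), sq_nonneg (B k h - C k h)]

/-! ### Eigenvalue and eigenvector perturbation -/

/-- Fewer homogeneous linear equations than unknowns have a nonzero solution. -/
lemma exists_ne_zero_of_card_lt {ι κ : Type*} [Fintype ι] [Fintype κ]
    (h : Fintype.card κ < Fintype.card ι) (f : (ι → ℝ) →ₗ[ℝ] (κ → ℝ)) : ∃ x, x ≠ 0 ∧ f x = 0 := by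
  have : f.ker ≠ ⊥ := LinearMap.ker_ne_bot_of_finrank_lt (by simpa using h)
  obtain ⟨x, hx, hx0⟩ := Submodule.exists_mem_ne_zero_of_ne_bot this
  exact ⟨x, hx0, hx⟩

lemma dotProduct_mulVec_mul_diagonal_mul_transpose (W : Matrix (Fin m) (Fin r) ℝ) (l : Fin r → ℝ)
    (x : Fin m → ℝ) :
    x ⬝ᵥ (W * Matrix.diagonal l * Wᵀ) *ᵥ x = ∑ i, l i * (Wᵀ *ᵥ x) i ^ 2 := by
  rw [← Matrix.mulVec_mulVec, ← Matrix.mulVec_mulVec, Matrix.dotProduct_mulVec,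
    ← Matrix.mulVec_transpose]
  simp only [dotProduct, Matrix.mulVec_diagonal]
  exact Finset.sum_congr rfl fun i _ => by ring

lemma IsEigendecomp.sum_sq {A Q : Matrix (Fin m) (Fin m) ℝ} {ev : Fin m → ℝ}
    (hQ : IsEigendecomp A Q ev) (x : Fin m → ℝ) : ∑ j, (Qᵀ *ᵥ x) j ^ 2 = x ⬝ᵥ x := by
  have h1 : Q * Qᵀ = 1 := mul_eq_one_comm.1 hQ.orthogonal
  have h2 : (Qᵀ *ᵥ x) ⬝ᵥ (Qᵀ *ᵥ x) = x ⬝ᵥ x := by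
    rw [Matrix.dotProduct_mulVec, ← Matrix.mulVec_transpose, Matrix.transpose_transpose,
      Matrix.mulVec_mulVec, h1, Matrix.one_mulVec]
  rw [← h2]; simp [dotProduct, sq]

/-- Bessel's inequality for a matrix with orthonormal columns. -/
lemma sum_sq_transpose_mulVec_le {W : Matrix (Fin m) (Fin r) ℝ} (hW : Wᵀ * W = 1)
    (x : Fin m → ℝ) : ∑ i, (Wᵀ *ᵥ x) i ^ 2 ≤ x ⬝ᵥ x := by
  have h := mulVec_dotProduct_self_le Wᵀ x
  have h1 : ‖Wᵀ‖ ^ 2 ≤ 1 := by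
    rw [opNorm_transpose]; exact pow_le_one₀ (norm_nonneg _) (opNorm_le_one_of_orth hW)
  calc ∑ i, (Wᵀ *ᵥ x) i ^ 2 = (Wᵀ *ᵥ x) ⬝ᵥ (Wᵀ *ᵥ x) := by simp [dotProduct, sq]
    _ ≤ _ := h.trans (mul_le_of_le_one_left (dotProduct_self_nonneg_real x) h1)

lemma dotProduct_self_pos_of_ne_zero {x : Fin m → ℝ} (hx : x ≠ 0) : 0 < x ⬝ᵥ x :=
  (dotProduct_self_nonneg_real x).lt_of_ne fun h => hx (dotProduct_self_eq_zero.1 h.symm)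

/-- **Weyl's inequality**, upper half: the eigenvalue number `j` of `A` exceeds the corresponding
eigenvalue of the rank `r` matrix `W diag(l) Wᵀ` by at most the size of the perturbation.  The bound
`b` is the eigenvalue number `j` of the low rank matrix, in the form of an upper bound on all `l i`
with `j ≤ i`. -/
lemma IsEigendecomp.ev_le {A Q : Matrix (Fin m) (Fin m) ℝ} {ev : Fin m → ℝ}
    (hQ : IsEigendecomp A Q ev) {W : Matrix (Fin m) (Fin r) ℝ} (hW : Wᵀ * W = 1)
    (l : Fin r → ℝ) (j : Fin m) {b : ℝ} (hb : 0 ≤ b) (hl : ∀ i : Fin r, j.val ≤ i.val → l i ≤ b) :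
    ev j ≤ b + ‖A - W * Matrix.diagonal l * Wᵀ‖ := by
  -- a vector in the span of the first `j + 1` eigenvectors orthogonal to the first `j` columns
  obtain ⟨x, hx0, hx⟩ : ∃ x : Fin m → ℝ, x ≠ 0 ∧ (∀ i, j < i → (Qᵀ *ᵥ x) i = 0) ∧
      ∀ i : Fin r, i.val < j.val → (Wᵀ *ᵥ x) i = 0 := by
    let f : (Fin m → ℝ) →ₗ[ℝ] ({i : Fin m // j < i} ⊕ Fin j.val → ℝ) :=
      { toFun := fun x => Sum.elim (fun i => (Qᵀ *ᵥ x) i.1)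
          fun i => if h : i.val < r then (Wᵀ *ᵥ x) ⟨i.val, h⟩ else 0
        map_add' := fun x y => by
          ext (i | i)
          · simp [Matrix.mulVec_add]
          · by_cases h : i.val < r <;> simp [Matrix.mulVec_add, h]
        map_smul' := fun a x => by
          ext (i | i)
          · simp [Matrix.mulVec_smul]
          · by_cases h : i.val < r <;> simp [Matrix.mulVec_smul, h] }
    obtain ⟨x, hx0, hx⟩ := exists_ne_zero_of_card_lt (by
      have hj := j.isLt
      simp [Fintype.card_subtype, Finset.filter_lt_eq_Ioi]
      omega) f
    refine ⟨x, hx0, fun i hi => ?_, fun i hi => ?_⟩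
    · exact congrFun hx (Sum.inl ⟨i, hi⟩)
    · simpa [f] using congrFun hx (Sum.inr ⟨i.val, hi⟩)
  have hxx := dotProduct_self_pos_of_ne_zero hx0
  have h1 : ev j * (x ⬝ᵥ x) ≤ x ⬝ᵥ A *ᵥ x := by
    rw [hQ.eq_mul, dotProduct_mulVec_mul_diagonal_mul_transpose, ← hQ.sum_sq, Finset.mul_sum]
    refine Finset.sum_le_sum fun i _ => ?_
    rcases le_or_gt i j with h | h
    · exact mul_le_mul_of_nonneg_right (hQ.antitone h) (sq_nonneg _)
    · simp [hx.1 i h]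
  have h2 : x ⬝ᵥ (W * Matrix.diagonal l * Wᵀ) *ᵥ x ≤ b * (x ⬝ᵥ x) := by
    rw [dotProduct_mulVec_mul_diagonal_mul_transpose]
    refine le_trans ?_ (mul_le_mul_of_nonneg_left (sum_sq_transpose_mulVec_le hW x) hb)
    rw [Finset.mul_sum]
    refine Finset.sum_le_sum fun i _ => ?_
    rcases lt_or_ge i.val j.val with h | h
    · simp [hx.2 i h]
    · exact mul_le_mul_of_nonneg_right (hl i h) (sq_nonneg _)
  have h3 := (le_abs_self _).trans
    (abs_dotProduct_mulVec_le (A - W * Matrix.diagonal l * Wᵀ) x x)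
  rw [Real.mul_self_sqrt hxx.le, Matrix.sub_mulVec, dotProduct_sub] at h3
  nlinarith

/-- **Weyl's inequality**, lower half, for the eigenvalues that correspond to the columns of `W`. -/
lemma IsEigendecomp.le_ev {A Q : Matrix (Fin m) (Fin m) ℝ} {ev : Fin m → ℝ}
    (hQ : IsEigendecomp A Q ev) {W : Matrix (Fin m) (Fin r) ℝ} (hW : Wᵀ * W = 1)
    {l : Fin r → ℝ} (hl : Antitone l) (j : Fin m) (i : Fin r) (hij : j.val = i.val) :
    l i - ‖A - W * Matrix.diagonal l * Wᵀ‖ ≤ ev j := by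
  obtain ⟨c, hc0, hc⟩ : ∃ c : Fin r → ℝ, c ≠ 0 ∧ (∀ k, i < k → c k = 0) ∧
      ∀ k : Fin m, k.val < j.val → (Qᵀ *ᵥ (W *ᵥ c)) k = 0 := by
    let f : (Fin r → ℝ) →ₗ[ℝ] ({k : Fin r // i < k} ⊕ Fin j.val → ℝ) :=
      { toFun := fun c => Sum.elim (fun k => c k.1)
          fun k => (Qᵀ *ᵥ (W *ᵥ c)) ⟨k.val, k.isLt.trans j.isLt⟩
        map_add' := fun x y => by
          ext (k | k) <;> simp [Matrix.mulVec_add]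
        map_smul' := fun a x => by
          ext (k | k) <;> simp [Matrix.mulVec_smul] }
    obtain ⟨x, hx0, hx⟩ := exists_ne_zero_of_card_lt (by
      have hi := i.isLt
      simp [Fintype.card_subtype, Finset.filter_lt_eq_Ioi]
      omega) f
    refine ⟨x, hx0, fun k hk => ?_, fun k hk => ?_⟩
    · exact congrFun hx (Sum.inl ⟨k, hk⟩)
    · simpa [f] using congrFun hx (Sum.inr ⟨k.val, hk⟩)
  set x := W *ᵥ c with hxdef
  have hWx : Wᵀ *ᵥ x = c := by rw [hxdef, Matrix.mulVec_mulVec, hW, Matrix.one_mulVec]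
  have hcx : x ⬝ᵥ x = c ⬝ᵥ c := by
    rw [hxdef, Matrix.dotProduct_mulVec, ← Matrix.mulVec_transpose, Matrix.mulVec_mulVec, hW,
      Matrix.one_mulVec]
  have hxx : 0 < x ⬝ᵥ x := hcx ▸ dotProduct_self_pos_of_ne_zero hc0
  have h1 : x ⬝ᵥ A *ᵥ x ≤ ev j * (x ⬝ᵥ x) := by
    rw [hQ.eq_mul, dotProduct_mulVec_mul_diagonal_mul_transpose, ← hQ.sum_sq, Finset.mul_sum]
    refine Finset.sum_le_sum fun k _ => ?_
    rcases lt_or_ge k j with h | h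
    · simp [hc.2 k h]
    · exact mul_le_mul_of_nonneg_right (hQ.antitone h) (sq_nonneg _)
  have h2 : l i * (x ⬝ᵥ x) ≤ x ⬝ᵥ (W * Matrix.diagonal l * Wᵀ) *ᵥ x := by
    rw [dotProduct_mulVec_mul_diagonal_mul_transpose, hWx, hcx, dotProduct, Finset.mul_sum]
    refine Finset.sum_le_sum fun k _ => ?_
    rcases le_or_gt k i with h | h
    · rw [← sq]; exact mul_le_mul_of_nonneg_right (hl h) (sq_nonneg _)
    · simp [hc.1 k h]
  have h3 := (neg_le_abs _).trans
    (abs_dotProduct_mulVec_le (A - W * Matrix.diagonal l * Wᵀ) x x)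
  rw [Real.mul_self_sqrt hxx.le, Matrix.sub_mulVec, dotProduct_sub] at h3
  nlinarith

lemma IsEigendecomp.mulVec_col {A Q : Matrix (Fin m) (Fin m) ℝ} {ev : Fin m → ℝ}
    (hQ : IsEigendecomp A Q ev) (j : Fin m) :
    (A *ᵥ fun k => Q k j) = ev j • fun k => Q k j := by
  have h : A * Q = Q * Matrix.diagonal ev := by
    rw [hQ.eq_mul, Matrix.mul_assoc, hQ.orthogonal, Matrix.mul_one]
  ext k
  have := congrFun (congrFun h k) j
  rw [Matrix.mul_diagonal] at this
  simpa [Matrix.mul_apply, Matrix.mulVec, dotProduct, mul_comm] using this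

lemma col_dotProduct_col {W : Matrix (Fin m) (Fin r) ℝ} (hW : Wᵀ * W = 1) (i j : Fin r) :
    (fun k => W k i) ⬝ᵥ (fun k => W k j) = if i = j then 1 else 0 := by
  have := congrFun (congrFun hW i) j
  simpa [Matrix.mul_apply, dotProduct, Matrix.one_apply] using this

/-- The eigenvalues beyond the rank of the unperturbed positive semidefinite matrix are small. -/
lemma IsEigendecomp.abs_ev_le {A Q : Matrix (Fin m) (Fin m) ℝ} {ev : Fin m → ℝ}
    (hQ : IsEigendecomp A Q ev) {W : Matrix (Fin m) (Fin r) ℝ} (hW : Wᵀ * W = 1)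
    {l : Fin r → ℝ} (hl : ∀ i, 0 ≤ l i) (j : Fin m) (hj : r ≤ j.val) :
    |ev j| ≤ ‖A - W * Matrix.diagonal l * Wᵀ‖ := by
  refine abs_le.2 ⟨?_, ?_⟩
  · set x : Fin m → ℝ := fun k => Q k j
    have hx : x ⬝ᵥ x = 1 := by simpa using col_dotProduct_col hQ.orthogonal j j
    have h1 : x ⬝ᵥ A *ᵥ x = ev j := by rw [hQ.mulVec_col, dotProduct_smul, hx]; simp
    have h2 : 0 ≤ x ⬝ᵥ (W * Matrix.diagonal l * Wᵀ) *ᵥ x := by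
      rw [dotProduct_mulVec_mul_diagonal_mul_transpose]
      exact Finset.sum_nonneg fun i _ => mul_nonneg (hl i) (sq_nonneg _)
    have h3 := (neg_le_abs _).trans
      (abs_dotProduct_mulVec_le (A - W * Matrix.diagonal l * Wᵀ) x x)
    rw [Matrix.sub_mulVec, dotProduct_sub, hx] at h3
    simp at h3
    linarith
  · simpa using hQ.ev_le hW l j le_rfl fun i hi => absurd i.isLt (by omega)

/-- **Davis–Kahan** for a single eigenvector: if the eigenvalue `l i` of `W diag(l) Wᵀ` is at distance
at least `g` from the rest of the spectrum (including `0`) and the perturbation is at most `g / 2`,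
then the corresponding eigenvectors agree, up to sign, to within a multiple of perturbation over
gap. -/
lemma IsEigendecomp.dist_sq_le {A Q : Matrix (Fin m) (Fin m) ℝ} {ev : Fin m → ℝ}
    (hQ : IsEigendecomp A Q ev) {W : Matrix (Fin m) (Fin r) ℝ} (hW : Wᵀ * W = 1)
    {l : Fin r → ℝ} (hl : Antitone l) (hl0 : ∀ i, 0 ≤ l i) (j : Fin m) (i : Fin r)
    (hij : j.val = i.val) {g : ℝ} (hg : 0 < g) (hgap : ∀ k, k ≠ i → g ≤ |l k - l i|)
    (hgi : g ≤ l i) (he : ‖A - W * Matrix.diagonal l * Wᵀ‖ ≤ g / 2) :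
    (((sgn ((fun k => Q k j) ⬝ᵥ fun k => W k i) : ℤ) : ℝ) • (fun k => Q k j) - fun k => W k i) ⬝ᵥ
      (((sgn ((fun k => Q k j) ⬝ᵥ fun k => W k i) : ℤ) : ℝ) • (fun k => Q k j) - fun k => W k i) ≤
      8 * ‖A - W * Matrix.diagonal l * Wᵀ‖ ^ 2 / g ^ 2 := by
  set e := ‖A - W * Matrix.diagonal l * Wᵀ‖ with hedef
  set v : Fin m → ℝ := fun k => Q k j with hv
  set w : Fin r → ℝ := Wᵀ *ᵥ v with hw
  have hvv : v ⬝ᵥ v = 1 := by simpa using col_dotProduct_col hQ.orthogonal j j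
  have hwi : v ⬝ᵥ (fun k => W k i) = w i := by
    simp [hw, Matrix.mulVec, dotProduct, mul_comm]
  have hWi : (fun k => W k i) ⬝ᵥ (fun k => W k i) = 1 := by simpa using col_dotProduct_col hW i i
  have hlo := hQ.le_ev hW hl j i hij
  have hup := hQ.ev_le hW l j (hl0 i) fun k hk => hl (Fin.le_def.2 (hij ▸ hk))
  rw [← hedef] at hlo hup
  -- the residual of `v` as an eigenvector of the low rank matrix, in the coordinates `w`
  have hres : ∑ k, (ev j - l k) ^ 2 * w k ^ 2 + ev j ^ 2 * (1 - ∑ k, w k ^ 2) ≤ e ^ 2 := by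
    have h1 := mulVec_dotProduct_self_le (A - W * Matrix.diagonal l * Wᵀ) v
    rw [hvv, mul_one, ← hedef] at h1
    have h2 : (A - W * Matrix.diagonal l * Wᵀ) *ᵥ v = ev j • v - W *ᵥ (fun k => l k * w k) := by
      rw [Matrix.sub_mulVec, hQ.mulVec_col, ← Matrix.mulVec_mulVec, ← Matrix.mulVec_mulVec]
      congr 2
      ext k; simp [Matrix.mulVec_diagonal, hw]
    have h3 : (W *ᵥ (fun k => l k * w k)) ⬝ᵥ (W *ᵥ (fun k => l k * w k)) =
        ∑ k, l k ^ 2 * w k ^ 2 := by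
      rw [Matrix.dotProduct_mulVec, ← Matrix.mulVec_transpose, Matrix.mulVec_mulVec, hW,
        Matrix.one_mulVec]
      exact Finset.sum_congr rfl fun k _ => by ring
    have h4 : v ⬝ᵥ (W *ᵥ (fun k => l k * w k)) = ∑ k, l k * w k ^ 2 := by
      rw [Matrix.dotProduct_mulVec, ← Matrix.mulVec_transpose]
      exact Finset.sum_congr rfl fun k _ => by ring
    rw [h2, sub_dotProduct, dotProduct_sub, dotProduct_sub, h3, smul_dotProduct, smul_dotProduct,
      dotProduct_smul, dotProduct_smul, hvv, dotProduct_comm _ v, h4] at h1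
    simp only [smul_eq_mul] at h1
    have h5 : ∑ k, (ev j - l k) ^ 2 * w k ^ 2 = ev j ^ 2 * ∑ k, w k ^ 2
        - 2 * ev j * ∑ k, l k * w k ^ 2 + ∑ k, l k ^ 2 * w k ^ 2 := by
      rw [Finset.mul_sum, Finset.mul_sum, ← Finset.sum_sub_distrib, ← Finset.sum_add_distrib]
      exact Finset.sum_congr rfl fun k _ => by ring
    rw [h5]; linarith
  have hbessel : ∑ k, w k ^ 2 ≤ 1 := hvv ▸ sum_sq_transpose_mulVec_le hW v
  have he0 : 0 ≤ e := norm_nonneg _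
  -- by Weyl, `ev j` is still at distance `g / 2` from `0` and from every `l k` with `k ≠ i`
  have hmain : (g / 2) ^ 2 * (1 - w i ^ 2) ≤ e ^ 2 := by
    refine le_trans ?_ hres
    have h1 : (g / 2) ^ 2 * (1 - ∑ k, w k ^ 2) ≤ ev j ^ 2 * (1 - ∑ k, w k ^ 2) :=
      mul_le_mul_of_nonneg_right (pow_le_pow_left₀ (by positivity) (by linarith) 2) (by linarith)
    have h2 : (g / 2) ^ 2 * (∑ k, w k ^ 2 - w i ^ 2) ≤ ∑ k, (ev j - l k) ^ 2 * w k ^ 2 := by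
      rw [← Finset.sum_erase_eq_sub (Finset.mem_univ i), Finset.mul_sum]
      refine le_trans (Finset.sum_le_sum fun k hk => ?_) (Finset.sum_le_sum_of_subset_of_nonneg
        (Finset.erase_subset i _) fun k _ _ => by positivity)
      refine mul_le_mul_of_nonneg_right ?_ (sq_nonneg _)
      rw [← sq_abs (ev j - l k)]
      refine pow_le_pow_left₀ (by positivity) ?_ 2
      have := hgap k (Finset.ne_of_mem_erase hk)
      rcases le_abs.1 this with h | h
      · rw [abs_sub_comm]; exact le_trans (by linarith) (le_abs_self _)
      · exact le_trans (by linarith) (le_abs_self _)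
    nlinarith
  have hkey : 1 - w i ^ 2 ≤ 4 * e ^ 2 / g ^ 2 := by
    rw [le_div_iff₀ (by positivity)]; nlinarith
  have hwle : w i ^ 2 ≤ 1 :=
    (Finset.single_le_sum (f := fun k => w k ^ 2) (fun k _ => sq_nonneg _)
      (Finset.mem_univ i)).trans hbessel
  rw [sub_dotProduct, dotProduct_sub, dotProduct_sub, smul_dotProduct, smul_dotProduct,
    dotProduct_smul, dotProduct_smul, hvv, hWi, dotProduct_comm _ v, hwi]
  have h8 : 8 * e ^ 2 / g ^ 2 = 2 * (4 * e ^ 2 / g ^ 2) := by ring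
  rw [h8]
  simp only [sgn, smul_eq_mul]
  split_ifs with h
  · simp
    nlinarith [abs_le.1 ((sq_le_one_iff_abs_le_one (w i)).1 hwle)]
  · simp
    nlinarith [abs_le.1 ((sq_le_one_iff_abs_le_one (w i)).1 hwle)]

end LinearAlgebra

section OperatorNormTail

open scoped Matrix.Norms.L2Operator

/-! ### A net of the sphere and the spectral norm of a random matrix -/

/-- The integer points `z` with `∑ i, z i ^ 2 ≤ 7 m`. Scaled by `1 / (2 √m)` they form a
`1 / 4`-net of the unit sphere of `ℝ ^ m`. -/
noncomputable def netGrid (m : ℕ) : Finset (Fin m → ℤ) :=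
  (Fintype.piFinset fun _ => Finset.Icc (-((7 * m : ℕ) : ℤ)) ((7 * m : ℕ) : ℤ)).filter
    fun z => ∑ i, z i ^ 2 ≤ 7 * m

/-- The point of the net that belongs to an integer vector. -/
noncomputable def netPoint {m : ℕ} (z : Fin m → ℤ) : Fin m → ℝ := fun i => (z i : ℝ) / (2 * √m)

lemma mem_netGrid {m : ℕ} {z : Fin m → ℤ} : z ∈ netGrid m ↔ ∑ i, z i ^ 2 ≤ 7 * m := by
  refine ⟨fun h => (Finset.mem_filter.1 h).2, fun h => Finset.mem_filter.2 ⟨?_, h⟩⟩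
  refine Fintype.mem_piFinset.2 fun i => Finset.mem_Icc.2 (abs_le.1 ?_)
  have h1 : z i ^ 2 ≤ 7 * m :=
    (Finset.single_le_sum (f := fun i => z i ^ 2) (fun _ _ => sq_nonneg _)
      (Finset.mem_univ i)).trans h
  have h2 : |z i| ≤ z i ^ 2 := by
    rw [← sq_abs]
    rcases (abs_nonneg (z i)).eq_or_lt with h0 | h0
    · rw [← h0]; simp
    · nlinarith
  push_cast; linarith

lemma sum_Icc_two_pow_neg_natAbs (R : ℕ) :
    ∑ k ∈ Finset.Icc (-(R : ℤ)) R, (1 / 2 : ℝ) ^ k.natAbs ≤ 3 - 2 * (1 / 2) ^ R := by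
  induction R with
  | zero => norm_num
  | succ R ih =>
    have h : Finset.Icc (-((R + 1 : ℕ) : ℤ)) ((R + 1 : ℕ) : ℤ) =
        insert (-((R + 1 : ℕ) : ℤ)) (insert ((R + 1 : ℕ) : ℤ) (Finset.Icc (-(R : ℤ)) R)) := by
      ext k; simp only [Finset.mem_Icc, Finset.mem_insert]; omega
    have h1 : -((R + 1 : ℕ) : ℤ) ∉ insert ((R + 1 : ℕ) : ℤ) (Finset.Icc (-(R : ℤ)) R) := by
      simp only [Finset.mem_Icc, Finset.mem_insert]; omega
    have h2 : ((R + 1 : ℕ) : ℤ) ∉ Finset.Icc (-(R : ℤ)) R := by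
      simp only [Finset.mem_Icc]; omega
    rw [h, Finset.sum_insert h1, Finset.sum_insert h2, Int.natAbs_neg, Int.natAbs_natCast, pow_succ]
    linarith

/-- The number of integer points in a ball of radius comparable to `√m` is exponential in `m`,
by weighting each point `z` with `2 ^ (-∑ |z i|)`, which factorises over the coordinates. -/
lemma card_netGrid_le (m : ℕ) : ((netGrid m).card : ℝ) ≤ 384 ^ m := by
  have h1 : ∀ z ∈ netGrid m, (1 / 2 : ℝ) ^ (7 * m) ≤ ∏ i, (1 / 2 : ℝ) ^ (z i).natAbs := by
    intro z hz
    rw [Finset.prod_pow_eq_pow_sum]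
    refine pow_le_pow_of_le_one (by norm_num) (by norm_num) ?_
    have h := mem_netGrid.1 hz
    have h2 : ((∑ i, (z i).natAbs : ℕ) : ℤ) ≤ ∑ i, z i ^ 2 := by
      push_cast
      refine Finset.sum_le_sum fun i _ => ?_
      rw [← sq_abs]
      rcases (abs_nonneg (z i)).eq_or_lt with h0 | h0
      · rw [← h0]; simp
      · nlinarith
    exact_mod_cast h2.trans h
  have h2 : (netGrid m).card * (1 / 2 : ℝ) ^ (7 * m) ≤ 3 ^ m := by
    rw [← nsmul_eq_mul]
    refine (Finset.card_nsmul_le_sum _ _ _ h1).trans ?_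
    refine (Finset.sum_le_sum_of_subset_of_nonneg (Finset.filter_subset _ _)
      fun z _ _ => by positivity).trans ?_
    rw [← Finset.prod_univ_sum (fun _ : Fin m =>
      Finset.Icc (-((7 * m : ℕ) : ℤ)) ((7 * m : ℕ) : ℤ)) fun _ k => (1 / 2 : ℝ) ^ k.natAbs]
    rw [Finset.prod_const, Finset.card_univ, Fintype.card_fin]
    refine pow_le_pow_left₀ (Finset.sum_nonneg fun _ _ => by positivity) ?_ m
    refine (sum_Icc_two_pow_neg_natAbs _).trans ?_
    have : (0 : ℝ) < (1 / 2) ^ (7 * m) := by positivity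
    linarith
  have h3 : (384 : ℝ) ^ m = 3 ^ m * 2 ^ (7 * m) := by
    rw [pow_mul, ← mul_pow]; norm_num
  rw [h3]
  calc ((netGrid m).card : ℝ) = (netGrid m).card * (1 / 2 : ℝ) ^ (7 * m) * 2 ^ (7 * m) := by
        rw [mul_assoc, ← mul_pow]; norm_num
    _ ≤ _ := mul_le_mul_of_nonneg_right h2 (by positivity)

lemma norm_netPoint_le {m : ℕ} {z : Fin m → ℤ} (hz : z ∈ netGrid m) :
    ‖WithLp.toLp 2 (netPoint z)‖ ≤ 4 / 3 := by
  refine le_of_sq_le_sq ?_ (by norm_num)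
  rw [← dotProduct_self_eq_norm_sq]
  rcases Nat.eq_zero_or_pos m with h | h
  · subst h; norm_num [dotProduct]
  have hm : (0 : ℝ) < m := by exact_mod_cast h
  have h1 : netPoint z ⬝ᵥ netPoint z = (∑ i, (z i : ℝ) ^ 2) / (4 * m) := by
    simp only [dotProduct, netPoint, Finset.sum_div]
    refine Finset.sum_congr rfl fun i _ => ?_
    rw [← sq, div_pow, mul_pow, Real.sq_sqrt hm.le]; norm_num
  have h2 : (∑ i, (z i : ℝ) ^ 2) ≤ 7 * m := by exact_mod_cast mem_netGrid.1 hz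
  rw [h1, div_le_iff₀ (by positivity)]
  linarith

lemma exists_netGrid_near {m : ℕ} {x : Fin m → ℝ} (hx : x ⬝ᵥ x = 1) :
    ∃ z ∈ netGrid m, ‖WithLp.toLp 2 (x - netPoint z)‖ ≤ 1 / 4 := by
  have hm : 0 < m := by
    rcases Nat.eq_zero_or_pos m with h | h
    · subst h; simp [dotProduct] at hx
    · exact h
  have hm' : (0 : ℝ) < m := by exact_mod_cast hm
  have hs : 0 < √(m : ℝ) := Real.sqrt_pos.2 hm'
  have hss : √(m : ℝ) ^ 2 = m := Real.sq_sqrt hm'.le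
  set z : Fin m → ℤ := fun i => round (2 * √m * x i) with hz
  have h1 : ‖WithLp.toLp 2 (x - netPoint z)‖ ≤ 1 / 4 := by
    refine le_of_sq_le_sq ?_ (by norm_num)
    rw [← dotProduct_self_eq_norm_sq]
    have : ∀ i, (x - netPoint z) i * (x - netPoint z) i ≤ 1 / (16 * m) := by
      intro i
      have h := abs_sub_round (2 * √m * x i)
      have h2 : (x - netPoint z) i = (2 * √m * x i - (z i : ℝ)) / (2 * √m) := by
        simp only [Pi.sub_apply, netPoint]; field_simp
      rw [h2, ← sq, div_pow, mul_pow, hss, ← sq_abs, div_le_div_iff₀ (by positivity) (by positivity)]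
      have h3 : |2 * √m * x i - (z i : ℝ)| ^ 2 ≤ (1 / 2) ^ 2 := pow_le_pow_left₀ (abs_nonneg _) h 2
      nlinarith
    calc _ ≤ ∑ _i : Fin m, (1 / (16 * m) : ℝ) := Finset.sum_le_sum fun i _ => this i
      _ = (1 / 4) ^ 2 := by
        simp; field_simp; norm_num
  have hx1 : ‖WithLp.toLp 2 x‖ = 1 := by rw [← sqrt_dotProduct_self, hx, Real.sqrt_one]
  have h2 : ‖WithLp.toLp 2 (netPoint z)‖ ≤ 5 / 4 := by
    have h3 : WithLp.toLp 2 (netPoint z) = WithLp.toLp 2 x - WithLp.toLp 2 (x - netPoint z) := by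
      simp
    rw [h3]
    refine (norm_sub_le _ _).trans ?_
    rw [hx1]; linarith
  refine ⟨z, mem_netGrid.2 ?_, h1⟩
  have h3 : (∑ i, (z i : ℝ) ^ 2) = 4 * m * (netPoint z ⬝ᵥ netPoint z) := by
    simp only [dotProduct, netPoint, Finset.mul_sum]
    refine Finset.sum_congr rfl fun i _ => ?_
    rw [← sq, div_pow, mul_pow, hss]; field_simp; norm_num
  rw [dotProduct_self_eq_norm_sq] at h3
  have h4 : ‖WithLp.toLp 2 (netPoint z)‖ ^ 2 ≤ (5 / 4) ^ 2 := pow_le_pow_left₀ (norm_nonneg _) h2 2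
  have h5 : (∑ i, (z i : ℝ) ^ 2) ≤ 7 * m := by rw [h3]; nlinarith
  exact_mod_cast h5

/-- The spectral norm is controlled by the values of the bilinear form on the net. -/
lemma opNorm_le_of_netGrid {n d : ℕ} (A : Matrix (Fin n) (Fin d) ℝ) {s : ℝ}
    (h : ∀ z ∈ netGrid n, ∀ w ∈ netGrid d, netPoint z ⬝ᵥ A *ᵥ netPoint w ≤ s) : ‖A‖ ≤ 3 * s := by
  have hs : 0 ≤ s := by
    have h0 := h 0 (mem_netGrid.2 (by simp)) 0 (mem_netGrid.2 (by simp))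
    have h1 : netPoint (0 : Fin n → ℤ) = 0 := by ext i; simp [netPoint]
    rw [h1] at h0; simpa using h0
  -- approximating both arguments from the net loses at most `1 / 4 + 4 / 3 * (1 / 4) = 7 / 12` of
  -- the norm
  have hunit : ∀ x y, x ⬝ᵥ x = 1 → y ⬝ᵥ y = 1 → x ⬝ᵥ A *ᵥ y ≤ s + 7 / 12 * ‖A‖ := by
    intro x y hx hy
    obtain ⟨z, hz, hz1⟩ := exists_netGrid_near hx
    obtain ⟨w, hw, hw1⟩ := exists_netGrid_near hy
    have e : x ⬝ᵥ A *ᵥ y = netPoint z ⬝ᵥ A *ᵥ netPoint w + (x - netPoint z) ⬝ᵥ A *ᵥ y +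
        netPoint z ⬝ᵥ A *ᵥ (y - netPoint w) := by
      rw [Matrix.mulVec_sub, dotProduct_sub, sub_dotProduct]; ring
    have h1 := (le_abs_self _).trans (abs_dotProduct_mulVec_le A (x - netPoint z) y)
    have h2 := (le_abs_self _).trans (abs_dotProduct_mulVec_le A (netPoint z) (y - netPoint w))
    rw [hy, Real.sqrt_one, mul_one, sqrt_dotProduct_self] at h1
    rw [sqrt_dotProduct_self, sqrt_dotProduct_self] at h2
    have h3 := h z hz w hw
    have h4 : ‖A‖ * ‖WithLp.toLp 2 (x - netPoint z)‖ ≤ ‖A‖ * (1 / 4) :=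
      mul_le_mul_of_nonneg_left hz1 (norm_nonneg _)
    have h5 : ‖A‖ * (‖WithLp.toLp 2 (netPoint z)‖ * ‖WithLp.toLp 2 (y - netPoint w)‖) ≤
        ‖A‖ * (4 / 3 * (1 / 4)) :=
      mul_le_mul_of_nonneg_left (mul_le_mul (norm_netPoint_le hz) hw1 (norm_nonneg _) (by norm_num)) (norm_nonneg _)
    rw [e]; linarith
  have hnn : 0 ≤ s + 7 / 12 * ‖A‖ := by positivity
  have key : ‖A‖ ≤ s + 7 / 12 * ‖A‖ := by
    refine opNorm_le_of_dotProduct_le A hnn fun x y => ?_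
    by_cases hx : x = 0
    · simp [hx]
    by_cases hy : y = 0
    · simp [hy]
    have hx' := Real.sqrt_pos.2 (dotProduct_self_pos_of_ne_zero hx)
    have hy' := Real.sqrt_pos.2 (dotProduct_self_pos_of_ne_zero hy)
    have hx2 := Real.sq_sqrt (dotProduct_self_nonneg_real x)
    have hy2 := Real.sq_sqrt (dotProduct_self_nonneg_real y)
    have h1 := hunit ((√(x ⬝ᵥ x))⁻¹ • x) ((√(y ⬝ᵥ y))⁻¹ • y)
      (by rw [smul_dotProduct, dotProduct_smul, smul_eq_mul, smul_eq_mul]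
          rw [← mul_assoc, ← sq, inv_pow, hx2]
          exact inv_mul_cancel₀ (dotProduct_self_pos_of_ne_zero hx).ne')
      (by rw [smul_dotProduct, dotProduct_smul, smul_eq_mul, smul_eq_mul]
          rw [← mul_assoc, ← sq, inv_pow, hy2]
          exact inv_mul_cancel₀ (dotProduct_self_pos_of_ne_zero hy).ne')
    rw [Matrix.mulVec_smul, smul_dotProduct, dotProduct_smul, smul_eq_mul, smul_eq_mul] at h1
    rw [inv_mul_eq_div, inv_mul_eq_div, div_div] at h1
    rw [mul_comm (√(x ⬝ᵥ x))]
    exact (div_le_iff₀ (mul_pos hy' hx')).1 h1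
  linarith

lemma hasSubgaussianMGF_mono {Ω : Type*} {mΩ : MeasurableSpace Ω} {μ : Measure Ω} {X : Ω → ℝ}
    {a b : ℝ≥0} (h : HasSubgaussianMGF X a μ) (hab : a ≤ b) : HasSubgaussianMGF X b μ where
  integrable_exp_mul := h.integrable_exp_mul
  mgf_le t := (h.mgf_le t).trans (Real.exp_le_exp.2 (by
    have : (a : ℝ) ≤ b := hab
    gcongr))

lemma measure_netPoint_ge_le {Ω : Type*} {mΩ : MeasurableSpace Ω} {μ : Measure Ω}
    [IsProbabilityMeasure μ] {n d : ℕ} {X : Ω → Matrix (Fin n) (Fin d) ℝ} {K : ℝ≥0}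
    (hind : iIndepFun (fun (kh : Fin n × Fin d) ω => X ω kh.1 kh.2) μ)
    (hX : ∀ k h, HasSubgaussianMGF (fun ω => X ω k h) K μ) (u : Fin n → ℝ) (w : Fin d → ℝ)
    (hu : ‖WithLp.toLp 2 u‖ ≤ 4 / 3) (hw : ‖WithLp.toLp 2 w‖ ≤ 4 / 3) {s : ℝ} (hs : 0 ≤ s) :
    μ {ω | s ≤ u ⬝ᵥ X ω *ᵥ w} ≤ ENNReal.ofReal (Real.exp (-s ^ 2 / (8 * K))) := by
  have h1 : iIndepFun (fun (kh : Fin n × Fin d) ω => u kh.1 * w kh.2 * X ω kh.1 kh.2) μ :=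
    hind.comp (fun kh x => u kh.1 * w kh.2 * x) fun kh => measurable_const.mul measurable_id
  have h2 := HasSubgaussianMGF.sum_of_iIndepFun h1 (s := Finset.univ)
    (c := fun kh => Real.toNNReal ((u kh.1 * w kh.2) ^ 2) * K) fun kh _ =>
      hasSubgaussianMGF_mono ((hX kh.1 kh.2).const_mul (u kh.1 * w kh.2))
        (le_of_eq (congrArg (· * K) (NNReal.eq (Real.coe_toNNReal _ (sq_nonneg _)).symm)))
  have h3 : (fun ω => ∑ kh : Fin n × Fin d, u kh.1 * w kh.2 * X ω kh.1 kh.2) =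
      fun ω => u ⬝ᵥ X ω *ᵥ w := by
    ext ω
    simp only [dotProduct, Matrix.mulVec, Finset.mul_sum, Fintype.sum_prod_type]
    exact Finset.sum_congr rfl fun k _ => Finset.sum_congr rfl fun h _ => by ring
  rw [h3] at h2
  have h4 := (hasSubgaussianMGF_mono (b := 4 * K) h2 (by
    rw [← NNReal.coe_le_coe]
    push_cast
    simp only [Real.coe_toNNReal _ (sq_nonneg _)]
    rw [← Finset.sum_mul]
    refine mul_le_mul_of_nonneg_right ?_ K.2
    simp only [Fintype.sum_prod_type, mul_pow, ← Finset.mul_sum, ← Finset.sum_mul]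
    have hu2 : ∑ k, u k ^ 2 = ‖WithLp.toLp 2 u‖ ^ 2 := by
      rw [← dotProduct_self_eq_norm_sq]; simp [dotProduct, sq]
    have hw2 : ∑ k, w k ^ 2 = ‖WithLp.toLp 2 w‖ ^ 2 := by
      rw [← dotProduct_self_eq_norm_sq]; simp [dotProduct, sq]
    rw [hu2, hw2, ← mul_pow]
    have : ‖WithLp.toLp 2 u‖ * ‖WithLp.toLp 2 w‖ ≤ 4 / 3 * (4 / 3) :=
      mul_le_mul hu hw (norm_nonneg _) (by norm_num)
    exact (pow_le_pow_left₀ (by positivity) this 2).trans (by norm_num))).measure_ge_le hs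
  rw [← ofReal_measureReal]
  refine ENNReal.ofReal_le_ofReal (h4.trans_eq ?_)
  push_cast; ring_nf

/-- Tail bound for the spectral norm of a random matrix with independent sub-Gaussian entries, by a
union bound over the net. -/
lemma measure_opNorm_gt_le {Ω : Type*} {mΩ : MeasurableSpace Ω} {μ : Measure Ω}
    [IsProbabilityMeasure μ] {n d : ℕ} {X : Ω → Matrix (Fin n) (Fin d) ℝ} {K : ℝ≥0}
    (hind : iIndepFun (fun (kh : Fin n × Fin d) ω => X ω kh.1 kh.2) μ)
    (hX : ∀ k h, HasSubgaussianMGF (fun ω => X ω k h) K μ) {s : ℝ} (hs : 0 ≤ s) :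
    μ {ω | 3 * s < ‖X ω‖} ≤ ENNReal.ofReal (384 ^ (n + d) * Real.exp (-s ^ 2 / (8 * K))) := by
  have hsub : {ω | 3 * s < ‖X ω‖} ⊆ ⋃ q ∈ netGrid n ×ˢ netGrid d,
      {ω | s ≤ netPoint q.1 ⬝ᵥ X ω *ᵥ netPoint q.2} := by
    intro ω hω
    by_contra hcon
    simp only [Set.mem_iUnion, Set.mem_ofPred_eq, not_exists, not_le, Finset.mem_product] at hcon
    exact absurd (opNorm_le_of_netGrid (X ω) fun z hz w hw => (hcon (z, w) ⟨hz, hw⟩).le)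
      (not_le.2 hω)
  refine (measure_mono hsub).trans ((measure_biUnion_finset_le _ _).trans ?_)
  refine (Finset.sum_le_sum fun q hq => measure_netPoint_ge_le hind hX _ _
    (norm_netPoint_le (Finset.mem_product.1 hq).1) (norm_netPoint_le (Finset.mem_product.1 hq).2)
    hs).trans ?_
  rw [Finset.sum_const, nsmul_eq_mul, ← ENNReal.ofReal_natCast, ← ENNReal.ofReal_mul (by positivity)]
  refine ENNReal.ofReal_le_ofReal (mul_le_mul_of_nonneg_right ?_ (Real.exp_pos _).le)
  rw [Finset.card_product, pow_add]
  push_cast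
  exact mul_le_mul (card_netGrid_le n) (card_netGrid_le d) (by positivity) (by positivity)

end OperatorNormTail

section MomentInequalities

variable {Ω : Type*} {mΩ : MeasurableSpace Ω} {μ : Measure Ω} [IsProbabilityMeasure μ]

/-! ### Moment inequalities for independent variables -/

lemma measure_ge_le_of_integral_le {f : Ω → ℝ} (hf : Integrable f μ) (h0 : ∀ ω, 0 ≤ f ω) {B t : ℝ}
    (hB : ∫ ω, f ω ∂μ ≤ B) (ht : 0 < t) : μ {ω | t ≤ f ω} ≤ ENNReal.ofReal (B / t) := by
  have h := mul_meas_ge_le_integral_of_nonneg (Eventually.of_forall h0) hf t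
  rw [← ofReal_measureReal]
  refine ENNReal.ofReal_le_ofReal ((le_div_iff₀ ht).2 ?_)
  linarith [mul_comm t (μ.real {ω | t ≤ f ω})]

lemma variance_sum_le {ι : Type*} [Fintype ι] {Z : ι → Ω → ℝ} (hm : ∀ i, MemLp (Z i) 2 μ)
    (hind : Pairwise fun i j => IndepFun (Z i) (Z j) μ) {v : ι → ℝ}
    (hv : ∀ i, ∫ ω, Z i ω ^ 2 ∂μ ≤ v i) : variance (∑ i, Z i) μ ≤ ∑ i, v i := by
  rw [IndepFun.variance_sum (fun i _ => hm i) (fun i _ j _ hij => hind hij)]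
  refine Finset.sum_le_sum fun i _ => (variance_le_expectation_sq (hm i).1).trans ?_
  simpa using hv i

lemma integral_sq_sum_le {ι : Type*} [Fintype ι] {Z : ι → Ω → ℝ} (hm : ∀ i, MemLp (Z i) 2 μ)
    (hind : Pairwise fun i j => IndepFun (Z i) (Z j) μ) (h0 : ∀ i, ∫ ω, Z i ω ∂μ = 0) {v : ℝ}
    (hv : ∀ i, ∫ ω, Z i ω ^ 2 ∂μ ≤ v) (a : ι → ℝ) :
    Integrable (fun ω => (∑ i, a i * Z i ω) ^ 2) μ ∧
      ∫ ω, (∑ i, a i * Z i ω) ^ 2 ∂μ ≤ v * ∑ i, a i ^ 2 := by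
  have hm' : ∀ i, MemLp (fun ω => a i * Z i ω) 2 μ := fun i => (hm i).const_mul (a i)
  have hsum : MemLp (∑ i, fun ω => a i * Z i ω) 2 μ := memLp_finsetSum' _ fun i _ => hm' i
  have he : (∑ i, fun ω => a i * Z i ω) = fun ω => ∑ i, a i * Z i ω := by ext ω; simp
  have hvar := variance_sum_le hm' (fun i j hij => (hind hij).comp
    (measurable_const.mul measurable_id) (measurable_const.mul measurable_id))
    (v := fun i => a i ^ 2 * v) (fun i => by
      simp only [mul_pow, integral_const_mul]
      exact mul_le_mul_of_nonneg_left (hv i) (sq_nonneg _))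
  have hmean : ∫ ω, (∑ i, fun ω => a i * Z i ω) ω ∂μ = 0 := by
    rw [he, integral_finsetSum _ fun i _ => (hm' i).integrable one_le_two]
    simp [integral_const_mul, h0]
  rw [variance_of_integral_eq_zero hsum.1.aemeasurable hmean, ← Finset.sum_mul] at hvar
  rw [he] at hvar hsum
  exact ⟨hsum.integrable_sq, by simpa [mul_comm] using hvar⟩

/-- **Chebyshev's inequality** for a sum of pairwise independent variables. -/
lemma measure_sum_deviation_le {ι : Type*} [Fintype ι] {Z : ι → Ω → ℝ} (hm : ∀ i, MemLp (Z i) 2 μ)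
    (hind : Pairwise fun i j => IndepFun (Z i) (Z j) μ) {v t : ℝ}
    (hv : ∀ i, ∫ ω, Z i ω ^ 2 ∂μ ≤ v) (ht : 0 < t) :
    μ {ω | t ≤ |∑ i, Z i ω - ∑ i, ∫ ω', Z i ω' ∂μ|} ≤
      ENNReal.ofReal (Fintype.card ι * v / t ^ 2) := by
  have hsum : MemLp (∑ i, Z i) 2 μ := memLp_finsetSum' _ fun i _ => hm i
  have h := meas_ge_le_variance_div_sq hsum ht
  have hvar := variance_sum_le hm hind hv
  simp only [Finset.sum_const, Finset.card_univ, nsmul_eq_mul] at hvar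
  simp only [Finset.sum_apply] at h
  rw [integral_finsetSum _ fun i _ => (hm i).integrable one_le_two] at h
  exact h.trans (ENNReal.ofReal_le_ofReal (by gcongr))

/-- Two mutually independent vectors, each with independent entries, have independent pairs of
entries. -/
lemma iIndepFun_prodMk {ι : Type*} [Fintype ι] {X Y : ι → Ω → ℝ} (hXm : ∀ i, Measurable (X i))
    (hYm : ∀ i, Measurable (Y i)) (hX : iIndepFun X μ) (hY : iIndepFun Y μ)
    (hXY : IndepFun (fun ω i => X i ω) (fun ω i => Y i ω) μ) :
    iIndepFun (fun i ω => (X i ω, Y i ω)) μ := by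
  have hpX : ∀ i, IsProbabilityMeasure (μ.map (X i)) := fun i =>
    Measure.isProbabilityMeasure_map (hXm i).aemeasurable
  have hpY : ∀ i, IsProbabilityMeasure (μ.map (Y i)) := fun i =>
    Measure.isProbabilityMeasure_map (hYm i).aemeasurable
  have hXv : Measurable fun ω i => X i ω := measurable_pi_lambda _ hXm
  have hYv : Measurable fun ω i => Y i ω := measurable_pi_lambda _ hYm
  rw [iIndepFun_iff_map_fun_eq_pi_map fun i => ((hXm i).prodMk (hYm i)).aemeasurable]
  have h1 := (iIndepFun_iff_map_fun_eq_pi_map fun i => (hXm i).aemeasurable).1 hX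
  have h2 := (iIndepFun_iff_map_fun_eq_pi_map fun i => (hYm i).aemeasurable).1 hY
  have h3 := (indepFun_iff_map_prod_eq_prod_map_map hXv.aemeasurable hYv.aemeasurable).1 hXY
  rw [h1, h2] at h3
  have h4 : ∀ i, μ.map (fun ω => (X i ω, Y i ω)) = (μ.map (X i)).prod (μ.map (Y i)) := fun i =>
    (indepFun_iff_map_prod_eq_prod_map_map (hXm i).aemeasurable (hYm i).aemeasurable).1
      (hXY.comp (measurable_pi_apply i) (measurable_pi_apply i))
  simp_rw [h4]
  set e := MeasurableEquiv.arrowProdEquivProdArrow ℝ ℝ ι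
  have h5 := (measurePreserving_arrowProdEquivProdArrow ℝ ℝ ι (fun i => μ.map (X i))
    (fun i => μ.map (Y i))).map_eq
  rw [← h3] at h5
  have h6 : (fun ω i => (X i ω, Y i ω)) = e.symm ∘ fun ω => (fun i => X i ω, fun i => Y i ω) := by
    ext ω i <;> rfl
  rw [h6, ← Measure.map_map e.symm.measurable (hXv.prodMk hYv), ← h5,
    Measure.map_map e.symm.measurable e.measurable, e.symm_comp_self, Measure.map_id]

end MomentInequalities

namespace Model

attribute [local instance] Model.mΩ Model.isProb

variable {r : ℕ} {p σ L : ℝ} {K : ℝ≥0} (S : Model.{u} r p σ L K)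

/-! ### Moments of the observations -/

/-- The centred observations `M - p M₀`, which have independent entries. -/
def noise (ω : S.Ω) : Matrix (Fin S.n) (Fin S.d) ℝ := S.M ω - p • S.M₀

lemma noise_apply (ω : S.Ω) (k : Fin S.n) (h : Fin S.d) :
    S.noise ω k h = S.y ω k h * (S.M₀ k h + S.ε ω k h) - p * S.M₀ k h := rfl

lemma M₀_sq_le (k : Fin S.n) (h : Fin S.d) : S.M₀ k h ^ 2 ≤ L ^ 2 := by
  rw [← sq_abs]; exact pow_le_pow_left₀ (abs_nonneg _) (S.bounded k h) 2

lemma iIndepFun_pair :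
    iIndepFun (fun (kh : Fin S.n × Fin S.d) ω => (S.y ω kh.1 kh.2, S.ε ω kh.1 kh.2)) S.μ :=
  iIndepFun_prodMk (fun kh => S.y_meas kh.1 kh.2) (fun kh => S.ε_meas kh.1 kh.2) S.y_indep
    S.ε_indep S.y_indep_ε

lemma indepFun_entry (k : Fin S.n) (h : Fin S.d) :
    IndepFun (fun ω => S.y ω k h) (fun ω => S.ε ω k h) S.μ :=
  S.y_indep_ε.comp (measurable_pi_apply (k, h)) (measurable_pi_apply (k, h))

lemma iIndepFun_noise : iIndepFun (fun (kh : Fin S.n × Fin S.d) ω => S.noise ω kh.1 kh.2) S.μ :=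
  S.iIndepFun_pair.comp (fun kh q => q.1 * (S.M₀ kh.1 kh.2 + q.2) - p * S.M₀ kh.1 kh.2)
    fun kh => by fun_prop

lemma y_sq (ω : S.Ω) (k : Fin S.n) (h : Fin S.d) : S.y ω k h ^ 2 = S.y ω k h := by
  rcases S.y_zero_or_one ω k h with h | h <;> simp [h]

lemma y_nonneg (ω : S.Ω) (k : Fin S.n) (h : Fin S.d) : 0 ≤ S.y ω k h := by
  rcases S.y_zero_or_one ω k h with h | h <;> simp [h]

lemma y_le_one (ω : S.Ω) (k : Fin S.n) (h : Fin S.d) : S.y ω k h ≤ 1 := by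
  rcases S.y_zero_or_one ω k h with h | h <;> simp [h]

lemma memLp_y (k : Fin S.n) (h : Fin S.d) (q : ℝ≥0∞) : MemLp (fun ω => S.y ω k h) q S.μ :=
  MemLp.of_bound (S.y_meas k h).aestronglyMeasurable 1 (Eventually.of_forall fun ω => by
    rw [Real.norm_of_nonneg (S.y_nonneg ω k h)]; exact S.y_le_one ω k h)

lemma integral_y (hp : 0 < p) (k : Fin S.n) (h : Fin S.d) : ∫ ω, S.y ω k h ∂S.μ = p := by
  have h1 : (fun ω => S.y ω k h) = Set.indicator {ω | S.y ω k h = 1} 1 := by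
    ext ω
    rcases S.y_zero_or_one ω k h with h | h <;> simp [h]
  have h2 : MeasurableSet {ω | S.y ω k h = 1} := S.y_meas k h (measurableSet_singleton 1)
  rw [h1, integral_indicator_one h2, Measure.real, S.y_bernoulli, ENNReal.toReal_ofReal hp.le]

lemma integrable_y_mul (k : Fin S.n) (h : Fin S.d) {g : ℝ → ℝ}
    (hgi : Integrable (fun ω => g (S.ε ω k h)) S.μ) :
    Integrable (fun ω => S.y ω k h * g (S.ε ω k h)) S.μ :=
  hgi.bdd_mul (S.y_meas k h).aestronglyMeasurable (c := 1) (Eventually.of_forall fun ω => by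
    rw [Real.norm_of_nonneg (S.y_nonneg ω k h)]; exact S.y_le_one ω k h)

/-- The observation indicator is independent of the noise in the same entry. -/
lemma integral_y_mul (hp : 0 < p) (k : Fin S.n) (h : Fin S.d) {g : ℝ → ℝ} (hg : Measurable g) :
    ∫ ω, S.y ω k h * g (S.ε ω k h) ∂S.μ = p * ∫ ω, g (S.ε ω k h) ∂S.μ := by
  have h1 : IndepFun (fun ω => S.y ω k h) (fun ω => g (S.ε ω k h)) S.μ :=
    (S.indepFun_entry k h).comp measurable_id hg
  rw [h1.integral_fun_mul_eq_mul_integral (S.y_meas k h).aestronglyMeasurable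
    (hg.comp (S.ε_meas k h)).aestronglyMeasurable, S.integral_y hp]

lemma memLp_ε (k : Fin S.n) (h : Fin S.d) : MemLp (fun ω => S.ε ω k h) 2 S.μ :=
  (S.ε_subG k h).memLp 2

lemma integral_ε_sq (k : Fin S.n) (h : Fin S.d) : ∫ ω, S.ε ω k h ^ 2 ∂S.μ = σ ^ 2 := by
  rw [← S.ε_var k h, variance_of_integral_eq_zero (S.ε_meas k h).aemeasurable (S.ε_mean k h)]

/-- First and second moments of `y (a + b ε)`. -/
lemma moments_y_affine (hp : 0 < p) (k : Fin S.n) (h : Fin S.d) (a b : ℝ) :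
    MemLp (fun ω => S.y ω k h * (a + b * S.ε ω k h)) 2 S.μ ∧
    ∫ ω, S.y ω k h * (a + b * S.ε ω k h) ∂S.μ = p * a ∧
    ∫ ω, (S.y ω k h * (a + b * S.ε ω k h)) ^ 2 ∂S.μ = p * (a ^ 2 + b ^ 2 * σ ^ 2) := by
  have hε : Integrable (fun ω => S.ε ω k h) S.μ := (S.memLp_ε k h).integrable one_le_two
  have hε2 : Integrable (fun ω => S.ε ω k h ^ 2) S.μ := (S.memLp_ε k h).integrable_sq
  refine ⟨?_, ?_, ?_⟩
  · have h1 : MemLp (fun ω => a + b * S.ε ω k h) 2 S.μ :=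
      (memLp_const a).add ((S.memLp_ε k h).const_mul b)
    refine h1.mono ((S.y_meas k h).mul (by have := S.ε_meas k h; fun_prop)).aestronglyMeasurable
      (Eventually.of_forall fun ω => ?_)
    rw [norm_mul, Real.norm_of_nonneg (S.y_nonneg ω k h)]
    exact mul_le_of_le_one_left (norm_nonneg _) (S.y_le_one ω k h)
  · rw [S.integral_y_mul hp k h (g := fun x => a + b * x) (by fun_prop),
      integral_add (integrable_const _) (hε.const_mul b), integral_const_mul, S.ε_mean]
    simp
  · have h1 : ∀ ω, (S.y ω k h * (a + b * S.ε ω k h)) ^ 2 =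
        S.y ω k h * (a + b * S.ε ω k h) ^ 2 := fun ω => by rw [mul_pow, S.y_sq]
    simp_rw [h1]
    rw [S.integral_y_mul hp k h (g := fun x => (a + b * x) ^ 2) (by fun_prop)]
    have h2 : ∀ ω, (a + b * S.ε ω k h) ^ 2 =
        a ^ 2 + 2 * a * b * S.ε ω k h + b ^ 2 * S.ε ω k h ^ 2 := fun ω => by ring
    simp_rw [h2]
    have h3 : Integrable (fun ω => a ^ 2 + 2 * a * b * S.ε ω k h) S.μ :=
      (integrable_const _).add (hε.const_mul _)
    rw [integral_add h3 (hε2.const_mul _),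
      integral_add (integrable_const _) (hε.const_mul _), integral_const_mul, integral_const_mul,
      S.ε_mean, S.integral_ε_sq]
    simp

lemma memLp_noise (hp : 0 < p) (k : Fin S.n) (h : Fin S.d) :
    MemLp (fun ω => S.noise ω k h) 2 S.μ := by
  have := (S.moments_y_affine hp k h (S.M₀ k h) 1).1.sub (memLp_const (p * S.M₀ k h))
  simp only [one_mul] at this
  exact this

lemma integral_noise (hp : 0 < p) (k : Fin S.n) (h : Fin S.d) : ∫ ω, S.noise ω k h ∂S.μ = 0 := by
  obtain ⟨h1, h2, -⟩ := S.moments_y_affine hp k h (S.M₀ k h) 1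
  simp only [one_mul] at h1 h2
  simp only [noise_apply]
  rw [integral_sub (h1.integrable one_le_two) (integrable_const _), h2]
  simp

lemma integral_noise_sq_le (hp : 0 < p) (k : Fin S.n) (h : Fin S.d) :
    ∫ ω, S.noise ω k h ^ 2 ∂S.μ ≤ p * (L ^ 2 + σ ^ 2) := by
  obtain ⟨h1, h2, h3⟩ := S.moments_y_affine hp k h (S.M₀ k h) 1
  simp only [one_mul] at h1 h2 h3
  have e : ∀ ω, S.noise ω k h ^ 2 = (S.y ω k h * (S.M₀ k h + S.ε ω k h)) ^ 2 -
      2 * (p * S.M₀ k h) * (S.y ω k h * (S.M₀ k h + S.ε ω k h)) + (p * S.M₀ k h) ^ 2 := fun ω => by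
    rw [noise_apply]; ring
  simp_rw [e]
  have h5 : Integrable (fun ω => (S.y ω k h * (S.M₀ k h + S.ε ω k h)) ^ 2 -
      2 * (p * S.M₀ k h) * (S.y ω k h * (S.M₀ k h + S.ε ω k h))) S.μ :=
    h1.integrable_sq.sub ((h1.integrable one_le_two).const_mul _)
  rw [integral_add h5 (integrable_const _), integral_sub h1.integrable_sq ((h1.integrable one_le_two).const_mul _),
    integral_const_mul, h2, h3]
  have h4 := S.M₀_sq_le k h
  simp
  nlinarith [sq_nonneg (p * S.M₀ k h), mul_le_mul_of_nonneg_left h4 hp.le]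

lemma hasSubgaussianMGF_y_mul_ε (hp : 0 < p) (hp1 : p ≤ 1) (k : Fin S.n) (h : Fin S.d) :
    HasSubgaussianMGF (fun ω => S.y ω k h * S.ε ω k h) K S.μ := by
  have hexp : ∀ t, (fun ω => Real.exp (t * (S.y ω k h * S.ε ω k h))) =
      fun ω => 1 + S.y ω k h * (Real.exp (t * S.ε ω k h) - 1) := fun t => by
    ext ω
    rcases S.y_zero_or_one ω k h with h | h <;> simp [h]
  have hint : ∀ t, Integrable (fun ω => Real.exp (t * S.ε ω k h) - 1) S.μ := fun t =>
    ((S.ε_subG k h).integrable_exp_mul t).sub (integrable_const _)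
  have hint2 : ∀ t, Integrable (fun ω => S.y ω k h * (Real.exp (t * S.ε ω k h) - 1)) S.μ :=
    fun t => S.integrable_y_mul k h (g := fun x => Real.exp (t * x) - 1) (hint t)
  refine ⟨fun t => ?_, fun t => ?_⟩
  · rw [hexp]; exact (integrable_const _).add (hint2 t)
  · rw [mgf, hexp, integral_add (integrable_const _) (hint2 t),
      S.integral_y_mul hp k h (g := fun x => Real.exp (t * x) - 1) (by fun_prop),
      integral_sub ((S.ε_subG k h).integrable_exp_mul t) (integrable_const _)]
    have h1 := (S.ε_subG k h).mgf_le t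
    rw [mgf] at h1
    have h2 : 1 ≤ Real.exp (K * t ^ 2 / 2) := Real.one_le_exp (by positivity)
    simp
    nlinarith

/-- The entries of the centred observations are sub-Gaussian: `(y - p) M₀` is bounded by
Hoeffding's lemma, and masking does not increase the variance proxy of the noise. -/
lemma hasSubgaussianMGF_noise (hp : 0 < p) (hp1 : p ≤ 1) (hL : 0 < L) (k : Fin S.n) (h : Fin S.d) :
    HasSubgaussianMGF (fun ω => S.noise ω k h) ((L.toNNReal + NNReal.sqrt K) ^ 2) S.μ := by
  have h1 : HasSubgaussianMGF (fun ω => S.y ω k h - p) 1 S.μ := by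
    refine hasSubgaussianMGF_mono (hasSubgaussianMGF_of_mem_Icc_of_integral_eq_zero
      (a := -p) (b := 1 - p) ((S.y_meas k h).sub_const p).aemeasurable
      (Eventually.of_forall fun ω => ⟨by linarith [S.y_nonneg ω k h],
        by linarith [S.y_le_one ω k h]⟩) ?_) ?_
    · rw [integral_sub ((S.memLp_y k h 2).integrable one_le_two) (integrable_const _),
        S.integral_y hp]
      simp
    · rw [← NNReal.coe_le_coe]
      norm_num
  have h2 := hasSubgaussianMGF_mono (b := (L ^ 2).toNNReal) (h1.const_mul (S.M₀ k h)) (by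
    refine NNReal.coe_le_coe.1 ?_
    rw [Real.coe_toNNReal _ (sq_nonneg L)]
    change S.M₀ k h ^ 2 * 1 ≤ L ^ 2
    rw [mul_one]
    exact S.M₀_sq_le k h)
  have h3 := h2.add (S.hasSubgaussianMGF_y_mul_ε hp hp1 k h)
  have h4 : NNReal.sqrt (L ^ 2).toNNReal = L.toNNReal := by
    rw [Real.toNNReal_pow hL.le, NNReal.sqrt_sq]
  rw [h4] at h3
  refine h3.congr (Eventually.of_forall fun ω => ?_)
  simp only [noise_apply]; ring

end Model

namespace Model

attribute [local instance] Model.mΩ Model.isProb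

open scoped Matrix.Norms.L2Operator

variable {r : ℕ} {p σ L : ℝ} {K : ℝ≥0} (S : Model.{u} r p σ L K)

/-! ### Singular vectors of the underlying matrix -/

lemma d_pos : (0 : ℝ) < S.d := by exact_mod_cast (Nat.zero_le r).trans_lt S.r_lt_d

lemma n_pos : (0 : ℝ) < S.n :=
  S.d_pos.trans_le (by exact_mod_cast S.d_le_n)

lemma d_le_n_real : (S.d : ℝ) ≤ S.n := by exact_mod_cast S.d_le_n

lemma one_le_d : (1 : ℝ) ≤ S.d := by exact_mod_cast (Nat.zero_le r).trans_lt S.r_lt_d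

lemma sqrt_nd_pos : 0 < √((S.n : ℝ) * S.d) := Real.sqrt_pos.2 (mul_pos S.n_pos S.d_pos)

lemma lam_eq (i : Fin r) : S.lam i = S.b i * √((S.n : ℝ) * S.d) := by
  rw [b, div_mul_cancel₀ _ S.sqrt_nd_pos.ne']

lemma Regular.le_lam {S : Model.{u} r p σ L K} {c α : ℝ} (hS : S.Regular c α) (i : Fin r) :
    √((S.n : ℝ) * S.d) / c ≤ S.lam i := by
  rw [S.lam_eq, div_eq_inv_mul, ← one_div]
  exact mul_le_mul_of_nonneg_right (hS.b_lower i) (Real.sqrt_nonneg _)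

lemma Regular.lam_le {S : Model.{u} r p σ L K} {c α : ℝ} (hS : S.Regular c α) (i : Fin r) :
    S.lam i ≤ c * √((S.n : ℝ) * S.d) := by
  rw [S.lam_eq]
  exact mul_le_mul_of_nonneg_right (hS.b_upper i) (Real.sqrt_nonneg _)

/-- The matrix with the singular vectors of `M₀` and coefficients `w`. -/
def withCoeffs (w : Fin r → ℝ) : Matrix (Fin S.n) (Fin S.d) ℝ := S.U * Matrix.diagonal w * S.Vᵀ

lemma withCoeffs_apply (w : Fin r → ℝ) (k : Fin S.n) (h : Fin S.d) :
    S.withCoeffs w k h = ∑ i, w i * (S.U k i * S.V h i) := by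
  rw [withCoeffs, Matrix.mul_apply]
  simp only [Matrix.mul_diagonal, Matrix.transpose_apply]
  exact Finset.sum_congr rfl fun i _ => by ring

lemma frobSq_eq_trace {n d : ℕ} (A : Matrix (Fin n) (Fin d) ℝ) : frobSq A = (Aᵀ * A).trace := by
  simp only [frobSq, Matrix.trace, Matrix.diag, Matrix.mul_apply, Matrix.transpose_apply, ← sq]
  exact Finset.sum_comm

lemma frobSq_withCoeffs (w : Fin r → ℝ) : frobSq (S.withCoeffs w) = ∑ i, w i ^ 2 := by
  have h : (S.withCoeffs w)ᵀ * S.withCoeffs w =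
      S.V * (Matrix.diagonal w * Matrix.diagonal w * S.Vᵀ) := by
    rw [withCoeffs, Matrix.transpose_mul, Matrix.transpose_mul, Matrix.transpose_transpose,
      Matrix.diagonal_transpose]
    calc S.V * (Matrix.diagonal w * S.Uᵀ) * (S.U * Matrix.diagonal w * S.Vᵀ)
        = S.V * (Matrix.diagonal w * ((S.Uᵀ * S.U) * Matrix.diagonal w) * S.Vᵀ) := by
          simp only [Matrix.mul_assoc]
      _ = _ := by rw [S.U_orth, Matrix.one_mul]
  rw [frobSq_eq_trace, h, Matrix.trace_mul_comm, Matrix.mul_assoc, S.V_orth, Matrix.mul_one,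
    Matrix.diagonal_mul_diagonal, Matrix.trace_diagonal]
  simp [sq]

lemma lam_mul_U (k : Fin S.n) (i : Fin r) : S.lam i * S.U k i = ∑ h, S.M₀ k h * S.V h i := by
  have h : S.M₀ * S.V = S.U * Matrix.diagonal S.lam := by
    rw [M₀, Matrix.mul_assoc, S.V_orth, Matrix.mul_one]
  have := congrFun (congrFun h k) i
  rw [Matrix.mul_apply, Matrix.mul_diagonal] at this
  rw [this, mul_comm]

lemma lam_mul_V (h : Fin S.d) (i : Fin r) : S.lam i * S.V h i = ∑ k, S.M₀ k h * S.U k i := by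
  have h1 : S.M₀ᵀ * S.U = S.V * Matrix.diagonal S.lam := by
    rw [M₀, Matrix.transpose_mul, Matrix.transpose_mul, Matrix.transpose_transpose,
      Matrix.diagonal_transpose, Matrix.mul_assoc, Matrix.mul_assoc, S.U_orth, Matrix.mul_one]
  have := congrFun (congrFun h1 h) i
  rw [Matrix.mul_apply, Matrix.mul_diagonal] at this
  simp only [Matrix.transpose_apply] at this
  rw [this, mul_comm]

lemma sum_sq_U (i : Fin r) : ∑ k, S.U k i ^ 2 = 1 := by
  simpa [dotProduct, sq] using col_dotProduct_col S.U_orth i i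

lemma sum_sq_V (i : Fin r) : ∑ h, S.V h i ^ 2 = 1 := by
  simpa [dotProduct, sq] using col_dotProduct_col S.V_orth i i

/-- The singular vectors are delocalised, because the entries of `M₀` are bounded: every rank one
component of `M₀` has bounded entries. -/
lemma Regular.abs_component_le {S : Model.{u} r p σ L K} {c α : ℝ} (hc : 0 < c) (hL : 0 < L)
    (hS : S.Regular c α) (k : Fin S.n) (h : Fin S.d) (i : Fin r) :
    |S.lam i * (S.U k i * S.V h i)| ≤ L ^ 2 * c := by
  have hn := S.n_pos
  have hd := S.d_pos
  have hU : (S.lam i * S.U k i) ^ 2 ≤ L ^ 2 * S.d := by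
    rw [lam_mul_U]
    refine (Finset.sum_mul_sq_le_sq_mul_sq _ _ _).trans ?_
    rw [S.sum_sq_V, mul_one]
    refine (Finset.sum_le_sum fun h _ => S.M₀_sq_le k h).trans (le_of_eq ?_)
    simp [mul_comm]
  have hV : (S.lam i * S.V h i) ^ 2 ≤ L ^ 2 * S.n := by
    rw [lam_mul_V]
    refine (Finset.sum_mul_sq_le_sq_mul_sq _ _ _).trans ?_
    rw [S.sum_sq_U, mul_one]
    refine (Finset.sum_le_sum fun k _ => S.M₀_sq_le k h).trans (le_of_eq ?_)
    simp [mul_comm]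
  have hlam := S.lam_pos i
  have h1 : (S.lam i * |S.lam i * (S.U k i * S.V h i)|) ≤ L ^ 2 * √((S.n : ℝ) * S.d) := by
    refine le_of_sq_le_sq ?_ (by positivity)
    rw [mul_pow, sq_abs, mul_pow (L ^ 2), Real.sq_sqrt (by positivity)]
    calc S.lam i ^ 2 * (S.lam i * (S.U k i * S.V h i)) ^ 2
        = (S.lam i * S.U k i) ^ 2 * (S.lam i * S.V h i) ^ 2 := by ring
      _ ≤ (L ^ 2 * S.d) * (L ^ 2 * S.n) :=
          mul_le_mul hU hV (sq_nonneg _) (by positivity)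
      _ = _ := by ring
  have h2 := hS.le_lam i
  have h3 := S.sqrt_nd_pos
  rw [div_le_iff₀ hc] at h2
  have h4 : S.lam i * |S.lam i * (S.U k i * S.V h i)| ≤ S.lam i * (L ^ 2 * c) :=
    h1.trans (by nlinarith [sq_nonneg L])
  exact le_of_mul_le_mul_left h4 hlam

/-- The difference between `M₀` with the signs of its singular values changed by `t` and `M₀`. -/
def signDiff (t : Fin r → ℤˣ) : Matrix (Fin S.n) (Fin S.d) ℝ :=
  S.withCoeffs fun i => (((t i : ℤ) : ℝ) - 1) * S.lam i

lemma Regular.abs_signDiff_le {S : Model.{u} r p σ L K} {c α : ℝ} (hc : 0 < c) (hL : 0 < L)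
    (hS : S.Regular c α) (t : Fin r → ℤˣ) (k : Fin S.n) (h : Fin S.d) :
    |S.signDiff t k h| ≤ 2 * r * (L ^ 2 * c) := by
  rw [signDiff, withCoeffs_apply]
  refine (Finset.abs_sum_le_sum_abs _ _).trans ?_
  have : ∀ i ∈ (Finset.univ : Finset (Fin r)),
      |(((t i : ℤ) : ℝ) - 1) * S.lam i * (S.U k i * S.V h i)| ≤ 2 * (L ^ 2 * c) := by
    intro i _
    rw [mul_assoc, abs_mul]
    refine mul_le_mul ?_ (hS.abs_component_le hc hL k h i) (abs_nonneg _) zero_le_two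
    rcases Int.units_eq_one_or (t i) with h | h <;> norm_num [h]
  refine (Finset.sum_le_sum this).trans (le_of_eq ?_)
  simp; ring

lemma Regular.le_frobSq_signDiff {S : Model.{u} r p σ L K} {c α : ℝ} (hc : 0 < c)
    (hS : S.Regular c α) {t : Fin r → ℤˣ} (ht : t ≠ 1) :
    4 / c ^ 2 * (S.n * S.d) ≤ frobSq (S.signDiff t) := by
  obtain ⟨i, hi⟩ := Function.ne_iff.1 ht
  have hi' : t i = -1 := (Int.units_eq_one_or (t i)).resolve_left hi
  rw [signDiff, frobSq_withCoeffs]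
  refine le_trans ?_ (Finset.single_le_sum (f := fun i => ((((t i : ℤ) : ℝ) - 1) * S.lam i) ^ 2)
    (fun _ _ => sq_nonneg _) (Finset.mem_univ i))
  have h1 : (√((S.n : ℝ) * S.d) / c) ^ 2 ≤ S.lam i ^ 2 :=
    pow_le_pow_left₀ (by positivity) (hS.le_lam i) 2
  rw [div_pow, Real.sq_sqrt (mul_pos S.n_pos S.d_pos).le] at h1
  simp only [hi']
  push_cast
  rw [show (4 : ℝ) / c ^ 2 * (S.n * S.d) = 4 * (S.n * S.d / c ^ 2) by ring]
  nlinarith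

/-! ### The good event -/

/-- The deterministic properties of an outcome from which the error bound follows. `A` controls the
fluctuations, `c` is the bound on the normalised singular values. -/
structure GoodOutcome (A c : ℝ) (ω : S.Ω) : Prop where
  noise_norm : ‖S.noise ω‖ ^ 2 ≤ p * √p * (S.n * √S.d)
  left : frobSq (S.Uᵀ * S.noise ω) ≤ A * (p * S.d)
  right : frobSq (S.noise ω * S.V) ≤ A * (p * S.n)
  proportion : |pHat (S.y ω) - p| ≤ A * √p / √((S.n : ℝ) * S.d)
  mass : frobSq (mask (S.y ω) (S.ε ω)) ≤ A * (S.n * S.d)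
  sign : ∀ t : Fin r → ℤˣ, t ≠ 1 → p / c ^ 2 * (S.n * S.d) ≤
    frobSq (mask (S.y ω) (S.signDiff t - S.ε ω)) - frobSq (mask (S.y ω) (S.ε ω))

lemma measure_left_le (hp : 0 < p) {t : ℝ} (ht : 0 < t) :
    S.μ {ω | t ≤ frobSq (S.Uᵀ * S.noise ω)} ≤
      ENNReal.ofReal (r * (S.d * (p * (L ^ 2 + σ ^ 2))) / t) := by
  have h1 : ∀ i h, Integrable (fun ω => (∑ k, S.U k i * S.noise ω k h) ^ 2) S.μ ∧
      ∫ ω, (∑ k, S.U k i * S.noise ω k h) ^ 2 ∂S.μ ≤ p * (L ^ 2 + σ ^ 2) * ∑ k, S.U k i ^ 2 :=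
    fun i h => integral_sq_sum_le (Z := fun k ω => S.noise ω k h) (fun k => S.memLp_noise hp k h)
      (fun k k' hk => S.iIndepFun_noise.indepFun (i := (k, h)) (j := (k', h)) (by simp [hk]))
      (fun k => S.integral_noise hp k h) (fun k => S.integral_noise_sq_le hp k h) _
  have e : (fun ω => frobSq (S.Uᵀ * S.noise ω)) =
      fun ω => ∑ i, ∑ h, (∑ k, S.U k i * S.noise ω k h) ^ 2 := by
    ext ω; simp [frobSq, Matrix.mul_apply]
  have hint : ∀ i, Integrable (fun ω => ∑ h, (∑ k, S.U k i * S.noise ω k h) ^ 2) S.μ :=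
    fun i => integrable_finsetSum _ fun h _ => (h1 i h).1
  refine measure_ge_le_of_integral_le (by
    rw [e]; exact integrable_finsetSum _ fun i _ => hint i) (fun ω => frobSq_nonneg _) ?_ ht
  rw [e, integral_finsetSum _ fun i _ => hint i]
  calc _ ≤ ∑ _i : Fin r, ∑ _h : Fin S.d, p * (L ^ 2 + σ ^ 2) := by
        refine Finset.sum_le_sum fun i _ => ?_
        rw [integral_finsetSum _ fun h _ => (h1 i h).1]
        refine Finset.sum_le_sum fun h _ => (h1 i h).2.trans (le_of_eq ?_)
        rw [S.sum_sq_U, mul_one]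
    _ = _ := by simp

lemma measure_right_le (hp : 0 < p) {t : ℝ} (ht : 0 < t) :
    S.μ {ω | t ≤ frobSq (S.noise ω * S.V)} ≤
      ENNReal.ofReal (r * (S.n * (p * (L ^ 2 + σ ^ 2))) / t) := by
  have h1 : ∀ i k, Integrable (fun ω => (∑ h, S.V h i * S.noise ω k h) ^ 2) S.μ ∧
      ∫ ω, (∑ h, S.V h i * S.noise ω k h) ^ 2 ∂S.μ ≤ p * (L ^ 2 + σ ^ 2) * ∑ h, S.V h i ^ 2 :=
    fun i k => integral_sq_sum_le (Z := fun h ω => S.noise ω k h) (fun h => S.memLp_noise hp k h)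
      (fun h h' hh => S.iIndepFun_noise.indepFun (i := (k, h)) (j := (k, h')) (by simp [hh]))
      (fun h => S.integral_noise hp k h) (fun h => S.integral_noise_sq_le hp k h) _
  have e : (fun ω => frobSq (S.noise ω * S.V)) =
      fun ω => ∑ i, ∑ k, (∑ h, S.V h i * S.noise ω k h) ^ 2 := by
    ext ω; rw [← frobSq_transpose]; simp [frobSq, Matrix.mul_apply, mul_comm]
  have hint : ∀ i, Integrable (fun ω => ∑ k, (∑ h, S.V h i * S.noise ω k h) ^ 2) S.μ :=
    fun i => integrable_finsetSum _ fun k _ => (h1 i k).1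
  refine measure_ge_le_of_integral_le (by
    rw [e]; exact integrable_finsetSum _ fun i _ => hint i) (fun ω => frobSq_nonneg _) ?_ ht
  rw [e, integral_finsetSum _ fun i _ => hint i]
  calc _ ≤ ∑ _i : Fin r, ∑ _k : Fin S.n, p * (L ^ 2 + σ ^ 2) := by
        refine Finset.sum_le_sum fun i _ => ?_
        rw [integral_finsetSum _ fun k _ => (h1 i k).1]
        refine Finset.sum_le_sum fun k _ => (h1 i k).2.trans (le_of_eq ?_)
        rw [S.sum_sq_V, mul_one]
    _ = _ := by simp

lemma measure_mass_le (hp : 0 < p) (hp1 : p ≤ 1) {t : ℝ} (ht : 0 < t) :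
    S.μ {ω | t ≤ frobSq (mask (S.y ω) (S.ε ω))} ≤
      ENNReal.ofReal (S.n * (S.d * σ ^ 2) / t) := by
  have h1 : ∀ k h, Integrable (fun ω => (S.y ω k h * S.ε ω k h) ^ 2) S.μ ∧
      ∫ ω, (S.y ω k h * S.ε ω k h) ^ 2 ∂S.μ ≤ σ ^ 2 := fun k h => by
    obtain ⟨h1, -, h3⟩ := S.moments_y_affine hp k h 0 1
    simp only [one_mul, zero_add] at h1 h3
    refine ⟨h1.integrable_sq, h3.trans_le ?_⟩
    nlinarith [sq_nonneg σ]
  have hint : ∀ k, Integrable (fun ω => ∑ h, (S.y ω k h * S.ε ω k h) ^ 2) S.μ :=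
    fun k => integrable_finsetSum _ fun h _ => (h1 k h).1
  refine measure_ge_le_of_integral_le (integrable_finsetSum _ fun k _ => hint k)
    (fun ω => frobSq_nonneg _) ?_ ht
  change ∫ ω, ∑ k, ∑ h, (S.y ω k h * S.ε ω k h) ^ 2 ∂S.μ ≤ _
  rw [integral_finsetSum _ fun k _ => hint k]
  calc _ ≤ ∑ _k : Fin S.n, ∑ _h : Fin S.d, σ ^ 2 := by
        refine Finset.sum_le_sum fun k _ => ?_
        rw [integral_finsetSum _ fun h _ => (h1 k h).1]
        exact Finset.sum_le_sum fun h _ => (h1 k h).2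
    _ = _ := by simp

lemma measure_proportion_le (hp : 0 < p) {t : ℝ} (ht : 0 < t) :
    S.μ {ω | t ≤ |pHat (S.y ω) - p|} ≤ ENNReal.ofReal (p / (S.n * S.d * t ^ 2)) := by
  have hn := S.n_pos
  have hd := S.d_pos
  have h := measure_sum_deviation_le (μ := S.μ)
    (Z := fun (kh : Fin S.n × Fin S.d) ω => S.y ω kh.1 kh.2) (fun kh => S.memLp_y kh.1 kh.2 2)
    (fun i j hij => S.y_indep.indepFun hij) (v := p) (t := t * (S.n * S.d))
    (fun kh => by simp only [y_sq]; rw [S.integral_y hp]) (by positivity)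
  simp only [S.integral_y hp, Fintype.sum_prod_type] at h
  refine le_trans (measure_mono fun ω hω => ?_) (h.trans_eq (congrArg _ ?_))
  · simp only [Set.mem_ofPred_eq] at hω ⊢
    have e : ∑ k, ∑ h, S.y ω k h - ∑ _k : Fin S.n, ∑ _h : Fin S.d, p =
        (pHat (S.y ω) - p) * (S.n * S.d) := by
      rw [pHat, sub_mul, div_mul_cancel₀ _ (by positivity)]
      simp; ring
    rw [e, abs_mul, abs_of_pos (a := (S.n : ℝ) * S.d) (by positivity)]
    exact mul_le_mul_of_nonneg_right hω (by positivity)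
  · simp only [Fintype.card_prod, Fintype.card_fin]
    push_cast
    field_simp

lemma measure_sign_le (hp : 0 < p) (D : Matrix (Fin S.n) (Fin S.d) ℝ) {B a : ℝ}
    (hB : ∀ k h, |D k h| ≤ B) (ha : 0 < a) (hD : 2 * (a * (S.n * S.d)) ≤ p * frobSq D) :
    S.μ {ω | frobSq (mask (S.y ω) (D - S.ε ω)) - frobSq (mask (S.y ω) (S.ε ω)) <
      a * (S.n * S.d)} ≤ ENNReal.ofReal (p * (B ^ 4 + 4 * B ^ 2 * σ ^ 2) / (a ^ 2 * (S.n * S.d))) := by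
  have hn := S.n_pos
  have hd := S.d_pos
  have hB2 : ∀ k h, D k h ^ 2 ≤ B ^ 2 := fun k h => by
    rw [← sq_abs]; exact pow_le_pow_left₀ (abs_nonneg _) (hB k h) 2
  have hm := fun k h => S.moments_y_affine hp k h (D k h ^ 2) (-2 * D k h)
  have hind : iIndepFun (fun (kh : Fin S.n × Fin S.d) ω =>
      S.y ω kh.1 kh.2 * (D kh.1 kh.2 ^ 2 + -2 * D kh.1 kh.2 * S.ε ω kh.1 kh.2)) S.μ :=
    S.iIndepFun_pair.comp (fun kh q => q.1 * (D kh.1 kh.2 ^ 2 + -2 * D kh.1 kh.2 * q.2))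
      fun kh => by fun_prop
  have h := measure_sum_deviation_le (μ := S.μ) (fun kh => (hm kh.1 kh.2).1)
    (fun i j hij => hind.indepFun hij) (v := p * (B ^ 4 + 4 * B ^ 2 * σ ^ 2))
    (t := a * (S.n * S.d)) (fun kh => by
      rw [(hm kh.1 kh.2).2.2]
      refine mul_le_mul_of_nonneg_left ?_ hp.le
      have h1 := hB2 kh.1 kh.2
      have h2 : (D kh.1 kh.2 ^ 2) ^ 2 ≤ (B ^ 2) ^ 2 := pow_le_pow_left₀ (sq_nonneg _) h1 2
      have h3 : D kh.1 kh.2 ^ 2 * σ ^ 2 ≤ B ^ 2 * σ ^ 2 :=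
        mul_le_mul_of_nonneg_right h1 (sq_nonneg _)
      nlinarith) (by positivity)
  refine le_trans (measure_mono fun ω hω => ?_) (h.trans_eq (congrArg _ ?_))
  · simp only [Set.mem_ofPred_eq] at hω ⊢
    have e1 : ∑ kh : Fin S.n × Fin S.d,
        ∫ ω, S.y ω kh.1 kh.2 * (D kh.1 kh.2 ^ 2 + -2 * D kh.1 kh.2 * S.ε ω kh.1 kh.2) ∂S.μ =
        p * frobSq D := by
      simp_rw [fun kh : Fin S.n × Fin S.d => (hm kh.1 kh.2).2.1]
      rw [← Finset.mul_sum, Fintype.sum_prod_type]; rfl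
    have e2 : ∑ kh : Fin S.n × Fin S.d,
        S.y ω kh.1 kh.2 * (D kh.1 kh.2 ^ 2 + -2 * D kh.1 kh.2 * S.ε ω kh.1 kh.2) =
        frobSq (mask (S.y ω) (D - S.ε ω)) - frobSq (mask (S.y ω) (S.ε ω)) := by
      simp only [frobSq, ← Finset.sum_sub_distrib]
      rw [Fintype.sum_prod_type]
      refine Finset.sum_congr rfl fun k _ => Finset.sum_congr rfl fun h _ => ?_
      simp only [mask, Matrix.of_apply, Matrix.sub_apply, mul_pow, S.y_sq]
      ring
    rw [e1, e2]
    refine le_trans ?_ (neg_le_abs _)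
    linarith
  · simp only [Fintype.card_prod, Fintype.card_fin]
    push_cast
    field_simp

end Model

namespace Model

attribute [local instance] Model.mΩ Model.isProb

open scoped Matrix.Norms.L2Operator

variable {r : ℕ} {p σ L : ℝ} {K : ℝ≥0}

/-- The spectral norm of the noise is of order `√n` up to constants that depend on `p`. The factor
`√d` to spare absorbs these constants and the entropy of the net. -/
lemma eventually_measure_noise_norm_le (σ : ℝ) (K : ℝ≥0) (hp : 0 < p) (hp1 : p ≤ 1) (hL : 0 < L)
    {θ : ℝ} (hθ : 0 < θ) :
    ∀ᶠ d : ℕ in atTop, ∀ S : Model.{u} r p σ L K, S.d = d →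
      S.μ {ω | p * √p * (S.n * √S.d) < ‖S.noise ω‖ ^ 2} ≤ ENNReal.ofReal θ := by
  set K' : ℝ≥0 := (L.toNNReal + NNReal.sqrt K) ^ 2 with hK'
  have hK0 : (0 : ℝ) < K' := by
    have : 0 < L.toNNReal := Real.toNNReal_pos.2 hL
    have : 0 < K' := by positivity
    exact_mod_cast this
  have h1 : ∀ᶠ d : ℕ in atTop, 13 * (72 * K') / (p * √p) ≤ √(d : ℝ) :=
    (Real.tendsto_sqrt_atTop.comp tendsto_natCast_atTop_atTop).eventually_ge_atTop _
  have h2 : ∀ᶠ d : ℕ in atTop, Real.exp (-(d : ℝ)) ≤ θ :=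
    ((Real.tendsto_exp_neg_atTop_nhds_zero.comp tendsto_natCast_atTop_atTop).eventually_lt_const
      hθ).mono fun _ h => h.le
  filter_upwards [h1, h2] with d hd1 hd2 S hS
  rw [← hS] at hd1 hd2
  have hn := S.n_pos
  have hd := S.d_pos
  have hsp : 0 < √p := Real.sqrt_pos.2 hp
  set e := p * √p * (S.n * √S.d) with he
  have he0 : 0 ≤ e := by positivity
  have hsub : {ω | e < ‖S.noise ω‖ ^ 2} ⊆ {ω | 3 * (√e / 3) < ‖S.noise ω‖} := fun ω hω => by
    simp only [Set.mem_ofPred_eq] at hω ⊢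
    rw [mul_div_cancel₀ _ (three_ne_zero)]
    exact (Real.sqrt_lt' (lt_of_pow_lt_pow_left₀ 2 (norm_nonneg _)
      (by simpa using he0.trans_lt hω))).2 hω
  refine (measure_mono hsub).trans ((measure_opNorm_gt_le S.iIndepFun_noise
    (S.hasSubgaussianMGF_noise hp hp1 hL) (by positivity)).trans ?_)
  refine ENNReal.ofReal_le_ofReal (le_trans ?_ hd2)
  rw [← hK', div_pow, Real.sq_sqrt he0]
  -- the net contributes at most `exp (12 n)`, and the tail is at most `exp (-13 n)` for large `d`
  have h3 : (384 : ℝ) ^ (S.n + S.d) ≤ Real.exp (12 * S.n) := by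
    have h4 : (384 : ℝ) ≤ Real.exp 6 := by
      have h5 : (2.7182818283 : ℝ) ^ 6 ≤ Real.exp 1 ^ 6 :=
        pow_le_pow_left₀ (by norm_num) Real.exp_one_gt_d9.le 6
      rw [← Real.exp_nat_mul] at h5
      norm_num at h5 ⊢
      linarith
    calc (384 : ℝ) ^ (S.n + S.d) ≤ Real.exp 6 ^ (S.n + S.d) :=
          pow_le_pow_left₀ (by norm_num) h4 _
      _ = Real.exp ((S.n + S.d : ℕ) * 6) := (Real.exp_nat_mul _ _).symm
      _ ≤ _ := Real.exp_le_exp.2 (by push_cast; linarith [S.d_le_n_real])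
  have h6 : 13 * (S.n : ℝ) ≤ e / 3 ^ 2 / (8 * K') := by
    rw [div_le_iff₀ (by positivity)] at hd1
    rw [div_div, le_div_iff₀ (by positivity), he]
    nlinarith [mul_le_mul_of_nonneg_right hd1 hn.le]
  calc (384 : ℝ) ^ (S.n + S.d) * Real.exp (-(e / 3 ^ 2) / (8 * K'))
      ≤ Real.exp (12 * S.n) * Real.exp (-(e / 3 ^ 2) / (8 * K')) :=
        mul_le_mul_of_nonneg_right h3 (Real.exp_pos _).le
    _ = Real.exp (12 * S.n - e / 3 ^ 2 / (8 * K')) := by rw [← Real.exp_add]; congr 1; ring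
    _ ≤ _ := Real.exp_le_exp.2 (by linarith [S.d_le_n_real])

/-- Changing the signs of some singular values of `M₀` increases the observed squared error by a
multiple of `n d`, with probability tending to one. -/
lemma eventually_measure_sign_le (r : ℕ) (σ L c α : ℝ) (K : ℝ≥0) (hp : 0 < p) (hL : 0 < L)
    (hc : 0 < c) {θ : ℝ} (hθ : 0 < θ) :
    ∀ᶠ d : ℕ in atTop, ∀ S : Model.{u} r p σ L K, S.d = d → S.Regular c α →
      S.μ (⋃ t ∈ (Finset.univ.filter fun t : Fin r → ℤˣ => t ≠ 1),
        {ω | frobSq (mask (S.y ω) (S.signDiff t - S.ε ω)) - frobSq (mask (S.y ω) (S.ε ω)) <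
          p / c ^ 2 * (S.n * S.d)}) ≤ ENNReal.ofReal θ := by
  set B := 2 * r * (L ^ 2 * c) with hB
  set a := p / c ^ 2 with ha
  have ha0 : 0 < a := by positivity
  have hsign : ∀ᶠ d : ℕ in atTop, 2 ^ r * (p * (B ^ 4 + 4 * B ^ 2 * σ ^ 2)) / (a ^ 2 * θ) ≤ d :=
    tendsto_natCast_atTop_atTop.eventually_ge_atTop _
  filter_upwards [hsign] with d hd2 S hS hreg
  have hn := S.n_pos
  have hd := S.d_pos
  refine (measure_biUnion_finset_le _ _).trans ((Finset.sum_le_sum fun t ht =>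
    S.measure_sign_le hp (S.signDiff t) (B := B) (a := a) (hreg.abs_signDiff_le hc hL t) ha0 ?_).trans
    ?_)
  · have h1 := mul_le_mul_of_nonneg_left
      (hreg.le_frobSq_signDiff hc (t := t) (Finset.mem_filter.1 ht).2) hp.le
    refine le_trans ?_ h1
    have : 0 ≤ a * (S.n * S.d) := by positivity
    calc 2 * (a * (S.n * S.d)) ≤ 4 * (a * (S.n * S.d)) := by linarith
      _ = _ := by rw [ha]; ring
  · rw [Finset.sum_const, nsmul_eq_mul, ← ENNReal.ofReal_natCast,
      ← ENNReal.ofReal_mul (by positivity)]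
    refine ENNReal.ofReal_le_ofReal ?_
    have hcard : ((Finset.univ.filter fun t : Fin r → ℤˣ => t ≠ 1).card : ℝ) ≤ 2 ^ r := by
      have := Finset.card_le_univ (Finset.univ.filter fun t : Fin r → ℤˣ => t ≠ 1)
      simp only [Fintype.card_pi, Fintype.card_units_int, Finset.prod_const, Finset.card_univ,
        Fintype.card_fin] at this
      exact_mod_cast this
    rw [← hS, div_le_iff₀ (by positivity)] at hd2
    set G := p * (B ^ 4 + 4 * B ^ 2 * σ ^ 2) with hG
    have hG0 : 0 ≤ G := by positivity
    calc _ ≤ 2 ^ r * (G / (a ^ 2 * (S.n * S.d))) :=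
          mul_le_mul_of_nonneg_right hcard (by positivity)
      _ ≤ 2 ^ r * (G / (a ^ 2 * (1 * S.d))) := by
          have : (1 : ℝ) ≤ S.n := S.one_le_d.trans S.d_le_n_real
          gcongr
      _ ≤ θ := by
          rw [one_mul, ← mul_div_assoc, div_le_iff₀ (by positivity)]
          linarith

/-- Outcomes are good with probability close to one, with fluctuations controlled by a constant `A`
that does not depend on `p`. -/
lemma exists_eventually_measure_not_goodOutcome_le (r : ℕ) (σ L c α : ℝ) (K : ℝ≥0) (hL : 0 < L)
    (hc : 0 < c) {η : ℝ} (hη : 0 < η) :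
    ∃ A : ℝ, 1 ≤ A ∧ ∀ p : ℝ, 0 < p → p ≤ 1 → ∀ᶠ d : ℕ in atTop,
      ∀ S : Model.{u} r p σ L K, S.d = d → S.Regular c α →
        S.μ {ω | ¬ S.GoodOutcome A c ω} ≤ ENNReal.ofReal η := by
  set v := L ^ 2 + σ ^ 2 with hv
  -- with this `A`, each of the six conditions fails with probability at most `η / 6`
  set A := 1 + 6 * (r * v + σ ^ 2 + 1) / η with hA
  have hv0 : 0 ≤ v := by positivity
  have hA1 : 1 ≤ A := by
    have : 0 ≤ 6 * (r * v + σ ^ 2 + 1) / η := by positivity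
    linarith
  have hA0 : 0 < A := zero_lt_one.trans_le hA1
  have hAη : 6 * (r * v + σ ^ 2 + 1) ≤ A * η := by
    rw [hA, add_mul, div_mul_cancel₀ _ hη.ne']; linarith
  have hrv : 0 ≤ r * v := by positivity
  have hAv : 6 * (r * v) ≤ A * η := by linarith [sq_nonneg σ]
  have hAσ : 6 * σ ^ 2 ≤ A * η := by linarith
  have hA6 : 6 ≤ A * η := by linarith [sq_nonneg σ]
  have hθ : 0 < η / 6 := by positivity
  refine ⟨A, hA1, fun p hp hp1 => ?_⟩
  filter_upwards [eventually_measure_noise_norm_le (r := r) σ K hp hp1 hL hθ,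
    eventually_measure_sign_le r σ L c α K hp hL hc hθ]
    with d hd1 hd2 S hS hreg
  have hn := S.n_pos
  have hd := S.d_pos
  have hsp : 0 < √p := Real.sqrt_pos.2 hp
  have hnd := S.sqrt_nd_pos
  have hndsq := Real.sq_sqrt (mul_pos hn hd).le
  have hpsq := Real.sq_sqrt hp.le
  have b1 := hd1 S hS
  have b2 : S.μ {ω | A * (p * S.d) ≤ frobSq (S.Uᵀ * S.noise ω)} ≤ ENNReal.ofReal (η / 6) := by
    refine (S.measure_left_le hp (by positivity)).trans (ENNReal.ofReal_le_ofReal ?_)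
    rw [div_le_iff₀ (by positivity)]
    linarith [mul_le_mul_of_nonneg_right hAv (mul_pos hp hd).le]
  have b3 : S.μ {ω | A * (p * S.n) ≤ frobSq (S.noise ω * S.V)} ≤ ENNReal.ofReal (η / 6) := by
    refine (S.measure_right_le hp (by positivity)).trans (ENNReal.ofReal_le_ofReal ?_)
    rw [div_le_iff₀ (by positivity)]
    linarith [mul_le_mul_of_nonneg_right hAv (mul_pos hp hn).le]
  have b4 : S.μ {ω | A * √p / √((S.n : ℝ) * S.d) ≤ |pHat (S.y ω) - p|} ≤
      ENNReal.ofReal (η / 6) := by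
    refine (S.measure_proportion_le hp (by positivity)).trans (ENNReal.ofReal_le_ofReal ?_)
    have e : (S.n : ℝ) * S.d * (A * √p / √((S.n : ℝ) * S.d)) ^ 2 = A ^ 2 * p := by
      rw [div_pow, mul_pow, hndsq, hpsq]; field_simp
    rw [e, div_le_iff₀ (by positivity)]
    have h1 : 1 * (A * η) ≤ A * (A * η) := mul_le_mul_of_nonneg_right hA1 (mul_pos hA0 hη).le
    have h2 : 6 ≤ A * (A * η) := by linarith
    linarith [mul_le_mul_of_nonneg_right h2 hp.le]
  have b5 : S.μ {ω | A * (S.n * S.d) ≤ frobSq (mask (S.y ω) (S.ε ω))} ≤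
      ENNReal.ofReal (η / 6) := by
    refine (S.measure_mass_le hp hp1 (by positivity)).trans (ENNReal.ofReal_le_ofReal ?_)
    rw [div_le_iff₀ (by positivity)]
    linarith [mul_le_mul_of_nonneg_right hAσ (mul_pos hn hd).le]
  have b6 := hd2 S hS hreg
  have hsub : {ω | ¬ S.GoodOutcome A c ω} ⊆
      ((((({ω | p * √p * (S.n * √S.d) < ‖S.noise ω‖ ^ 2} ∪
        {ω | A * (p * S.d) ≤ frobSq (S.Uᵀ * S.noise ω)}) ∪
        {ω | A * (p * S.n) ≤ frobSq (S.noise ω * S.V)}) ∪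
        {ω | A * √p / √((S.n : ℝ) * S.d) ≤ |pHat (S.y ω) - p|}) ∪
        {ω | A * (S.n * S.d) ≤ frobSq (mask (S.y ω) (S.ε ω))}) ∪
        ⋃ t ∈ (Finset.univ.filter fun t : Fin r → ℤˣ => t ≠ 1),
          {ω | frobSq (mask (S.y ω) (S.signDiff t - S.ε ω)) - frobSq (mask (S.y ω) (S.ε ω)) <
            p / c ^ 2 * (S.n * S.d)}) := by
    intro ω hω
    by_contra hcon
    simp only [Set.mem_union, not_or, Set.mem_iUnion, Set.mem_ofPred_eq, not_exists, not_le, not_lt,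
      Finset.mem_filter, Finset.mem_univ, true_and] at hcon
    obtain ⟨⟨⟨⟨⟨c1, c2⟩, c3⟩, c4⟩, c5⟩, c6⟩ := hcon
    exact hω ⟨c1, c2.le, c3.le, c4.le, c5.le, fun t ht => c6 t ht⟩
  refine (measure_mono hsub).trans ?_
  refine (measure_union_le _ _).trans ((add_le_add ((measure_union_le _ _).trans (add_le_add
    ((measure_union_le _ _).trans (add_le_add ((measure_union_le _ _).trans (add_le_add
    ((measure_union_le _ _).trans (add_le_add b1 b2)) b3)) b4)) b5)) b6).trans (le_of_eq ?_))
  rw [← ENNReal.ofReal_add (by positivity) hθ.le, ← ENNReal.ofReal_add (by positivity) hθ.le,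
    ← ENNReal.ofReal_add (by positivity) hθ.le, ← ENNReal.ofReal_add (by positivity) hθ.le,
    ← ENNReal.ofReal_add (by positivity) hθ.le]
  congr 1; ring

end Model

open scoped Matrix.Norms.L2Operator

/-! ### The adjusted Gram matrix is close to the scaled Gram matrix of `M₀` -/

section AdjustedGram

variable {n d r : ℕ}

/-- Writing `X = p M₀ + N`, the cross terms of `XᵀX` only involve the projection of the noise on the
`r` singular vectors, and the diagonal correction is at most the largest squared column norm. -/
lemma norm_adjGram_sub_le {U : Matrix (Fin n) (Fin r) ℝ} {V : Matrix (Fin d) (Fin r) ℝ}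
    (hU : Uᵀ * U = 1) (hV : Vᵀ * V = 1) {lam : Fin r → ℝ} {p q L b : ℝ} (hp : 0 ≤ p) (hp1 : p ≤ 1)
    (hq : 0 ≤ q) (hq1 : q ≤ 1) (hb : 0 ≤ b) (hlam : ∀ i, |lam i| ≤ b)
    (X : Matrix (Fin n) (Fin d) ℝ) (hL : ∀ k h, (U * Matrix.diagonal lam * Vᵀ) k h ^ 2 ≤ L ^ 2) :
    ‖adjGram q X - V * Matrix.diagonal (fun i => p ^ 2 * lam i ^ 2) * Vᵀ‖ ≤
      2 * p * (b * √(frobSq (Uᵀ * (X - p • (U * Matrix.diagonal lam * Vᵀ))))) +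
      3 * ‖X - p • (U * Matrix.diagonal lam * Vᵀ)‖ ^ 2 + 2 * (n * L ^ 2) := by
  set M₀ := U * Matrix.diagonal lam * Vᵀ with hM₀
  set N := X - p • M₀ with hN
  have hX : X = p • M₀ + N := by rw [hN]; abel
  have hM₀T : M₀ᵀ = V * Matrix.diagonal lam * Uᵀ := by
    rw [hM₀, Matrix.transpose_mul, Matrix.transpose_mul, Matrix.transpose_transpose,
      Matrix.diagonal_transpose, Matrix.mul_assoc]
  have hgram : M₀ᵀ * M₀ = V * Matrix.diagonal (fun i => lam i ^ 2) * Vᵀ := by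
    calc M₀ᵀ * M₀ = V * (Matrix.diagonal lam * ((Uᵀ * U) * Matrix.diagonal lam)) * Vᵀ := by
          rw [hM₀T, hM₀]; simp only [Matrix.mul_assoc]
      _ = _ := by
          rw [hU, Matrix.one_mul, Matrix.diagonal_mul_diagonal]
          simp only [sq]
  have hmain : V * Matrix.diagonal (fun i => p ^ 2 * lam i ^ 2) * Vᵀ = p ^ 2 • (M₀ᵀ * M₀) := by
    have : Matrix.diagonal (fun i => p ^ 2 * lam i ^ 2) =
        p ^ 2 • Matrix.diagonal (fun i => lam i ^ 2) := by
      rw [← Matrix.diagonal_smul]; rfl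
    rw [hgram, this, Matrix.mul_smul, Matrix.smul_mul]
  have hdecomp : adjGram q X - V * Matrix.diagonal (fun i => p ^ 2 * lam i ^ 2) * Vᵀ =
      p • (M₀ᵀ * N) + p • (Nᵀ * M₀) + Nᵀ * N -
        (1 - q) • Matrix.diagonal (Matrix.diag (Xᵀ * X)) := by
    rw [hmain, adjGram]
    nth_rw 1 2 [hX]
    simp only [Matrix.transpose_add, Matrix.transpose_smul, Matrix.add_mul, Matrix.mul_add,
      Matrix.smul_mul, Matrix.mul_smul, smul_add, smul_smul, sq]
    abel
  have hcross : ‖M₀ᵀ * N‖ ≤ b * √(frobSq (Uᵀ * N)) := by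
    rw [hM₀T, Matrix.mul_assoc, Matrix.mul_assoc]
    refine (Matrix.l2_opNorm_mul _ _).trans ((mul_le_of_le_one_left (norm_nonneg _)
      (opNorm_le_one_of_orth hV)).trans ((Matrix.l2_opNorm_mul _ _).trans ?_))
    exact mul_le_mul (opNorm_diagonal_le hb hlam) (opNorm_le_sqrt_frobSq _) (norm_nonneg _) hb
  have hcross' : ‖Nᵀ * M₀‖ ≤ b * √(frobSq (Uᵀ * N)) := by
    rw [← opNorm_transpose, Matrix.transpose_mul, Matrix.transpose_transpose]; exact hcross
  have hdiag : ‖(1 - q) • Matrix.diagonal (Matrix.diag (Xᵀ * X))‖ ≤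
      2 * (n * L ^ 2) + 2 * ‖N‖ ^ 2 := by
    rw [norm_smul, Real.norm_of_nonneg (by linarith)]
    refine (mul_le_of_le_one_left (norm_nonneg _) (by linarith)).trans
      (opNorm_diagonal_le (by positivity) fun h => ?_)
    have e : Matrix.diag (Xᵀ * X) h = ∑ k, X k h ^ 2 := by
      simp [Matrix.diag, Matrix.mul_apply, sq]
    rw [e, abs_of_nonneg (Finset.sum_nonneg fun _ _ => sq_nonneg _)]
    have hk : ∀ k, X k h ^ 2 ≤ 2 * L ^ 2 + 2 * N k h ^ 2 := fun k => by
      have e1 : X k h = p * M₀ k h + N k h := by rw [hX]; simp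
      have e2 : (p * M₀ k h) ^ 2 ≤ L ^ 2 := by
        rw [mul_pow]
        exact (mul_le_of_le_one_left (sq_nonneg _) (pow_le_one₀ hp hp1)).trans (hL k h)
      rw [e1]
      nlinarith [sq_nonneg (p * M₀ k h - N k h)]
    refine (Finset.sum_le_sum fun k _ => hk k).trans ?_
    rw [Finset.sum_add_distrib, ← Finset.mul_sum, ← Finset.mul_sum]
    have := sum_sq_col_le N h
    simp only [Finset.sum_const, Finset.card_univ, Fintype.card_fin, nsmul_eq_mul]
    linarith
  rw [hdecomp]
  have t1 : ‖p • (M₀ᵀ * N)‖ ≤ p * (b * √(frobSq (Uᵀ * N))) := by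
    rw [norm_smul, Real.norm_of_nonneg hp]; exact mul_le_mul_of_nonneg_left hcross hp
  have t2 : ‖p • (Nᵀ * M₀)‖ ≤ p * (b * √(frobSq (Uᵀ * N))) := by
    rw [norm_smul, Real.norm_of_nonneg hp]; exact mul_le_mul_of_nonneg_left hcross' hp
  have t3 := (opNorm_transpose_mul_self N).le
  have t4 := norm_sub_le (p • (M₀ᵀ * N) + p • (Nᵀ * M₀) + Nᵀ * N)
    ((1 - q) • Matrix.diagonal (Matrix.diag (Xᵀ * X)))
  have t5 := norm_add₃_le (a := p • (M₀ᵀ * N)) (b := p • (Nᵀ * M₀)) (c := Nᵀ * N)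
  linarith

end AdjustedGram

namespace Model

variable {r : ℕ} {p σ L : ℝ} {K : ℝ≥0} {S : Model.{u} r p σ L K}

lemma pHat_nonneg (ω : S.Ω) : 0 ≤ pHat (S.y ω) :=
  div_nonneg (Finset.sum_nonneg fun k _ => Finset.sum_nonneg fun h _ => S.y_nonneg ω k h)
    (mul_pos S.n_pos S.d_pos).le

lemma pHat_le_one (ω : S.Ω) : pHat (S.y ω) ≤ 1 := by
  rw [pHat, div_le_one (mul_pos S.n_pos S.d_pos)]
  calc ∑ k, ∑ h, S.y ω k h ≤ ∑ _k : Fin S.n, ∑ _h : Fin S.d, (1 : ℝ) :=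
        Finset.sum_le_sum fun k _ => Finset.sum_le_sum fun h _ => S.y_le_one ω k h
    _ = _ := by simp

lemma Regular.abs_lam_le {c α : ℝ} (hreg : S.Regular c α) (i : Fin r) :
    |S.lam i| ≤ c * √((S.n : ℝ) * S.d) := by
  rw [abs_of_pos (S.lam_pos i)]; exact hreg.lam_le i

/-- The perturbation of the `d × d` Gram matrix on a good outcome. -/
lemma GoodOutcome.norm_sigmaHat_sub_le {A c α : ℝ} {ω : S.Ω} (hG : S.GoodOutcome A c ω)
    (hreg : S.Regular c α) (hp : 0 < p) (hp1 : p ≤ 1) (hc : 0 < c) (hA : 1 ≤ A)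
    (hd : L ^ 2 ≤ p * √p * √S.d) :
    ‖S.sigmaHat ω - S.V * Matrix.diagonal (fun i => p ^ 2 * S.lam i ^ 2) * S.Vᵀ‖ ≤
      (2 * c * A + 5) * (p * √p * (S.n * √S.d)) := by
  have hn := S.n_pos
  have hd0 := S.d_pos
  refine (norm_adjGram_sub_le S.U_orth S.V_orth hp.le hp1 (pHat_nonneg ω) (pHat_le_one ω)
    (by positivity) hreg.abs_lam_le (S.M ω) S.M₀_sq_le).trans ?_
  change 2 * p * (c * √((S.n : ℝ) * S.d) * √(frobSq (S.Uᵀ * S.noise ω))) + 3 * ‖S.noise ω‖ ^ 2 +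
    2 * (S.n * L ^ 2) ≤ _
  have h1 := hG.noise_norm
  have h2 : √(frobSq (S.Uᵀ * S.noise ω)) ≤ A * (√p * √S.d) := by
    refine Real.sqrt_le_iff.2 ⟨by positivity, hG.left.trans ?_⟩
    rw [mul_pow, mul_pow, Real.sq_sqrt hp.le, Real.sq_sqrt hd0.le]
    exact mul_le_mul_of_nonneg_right (by nlinarith) (by positivity)
  have h3 : S.n * L ^ 2 ≤ p * √p * (S.n * √S.d) := by nlinarith
  have h4 : √((S.n : ℝ) * S.d) * √S.d ≤ S.n * √S.d := by
    refine mul_le_mul_of_nonneg_right (Real.sqrt_le_iff.2 ⟨hn.le, ?_⟩) (Real.sqrt_nonneg _)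
    rw [sq]; exact mul_le_mul_of_nonneg_left S.d_le_n_real hn.le
  have h5 : 2 * p * (c * √((S.n : ℝ) * S.d) * √(frobSq (S.Uᵀ * S.noise ω))) ≤
      2 * c * A * (p * √p * (S.n * √S.d)) := by
    calc _ ≤ 2 * p * (c * √((S.n : ℝ) * S.d) * (A * (√p * √S.d))) := by gcongr
      _ = 2 * c * A * (p * √p * (√((S.n : ℝ) * S.d) * √S.d)) := by ring
      _ ≤ _ := by gcongr
  linarith

/-- The perturbation of the `n × n` Gram matrix on a good outcome. -/
lemma GoodOutcome.norm_sigmaHatT_sub_le {A c α : ℝ} {ω : S.Ω} (hG : S.GoodOutcome A c ω)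
    (hreg : S.Regular c α) (hp : 0 < p) (hp1 : p ≤ 1) (hc : 0 < c) (hA : 1 ≤ A)
    (hd : L ^ 2 ≤ p * √p * √S.d) :
    ‖S.sigmaHatT ω - S.U * Matrix.diagonal (fun i => p ^ 2 * S.lam i ^ 2) * S.Uᵀ‖ ≤
      (2 * c * A + 5) * (p * √p * (S.n * √S.d)) := by
  have hn := S.n_pos
  have hd0 := S.d_pos
  have hT : S.V * Matrix.diagonal S.lam * S.Uᵀ = S.M₀ᵀ := by
    rw [M₀, Matrix.transpose_mul, Matrix.transpose_mul, Matrix.transpose_transpose,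
      Matrix.diagonal_transpose, Matrix.mul_assoc]
  have h0 := norm_adjGram_sub_le S.V_orth S.U_orth (lam := S.lam) (L := L) hp.le hp1
    (pHat_nonneg ω) (pHat_le_one ω) (b := c * √((S.n : ℝ) * S.d)) (by positivity) hreg.abs_lam_le
    (S.M ω)ᵀ (by rw [hT]; exact fun h k => S.M₀_sq_le k h)
  have hN : (S.M ω)ᵀ - p • (S.V * Matrix.diagonal S.lam * S.Uᵀ) = (S.noise ω)ᵀ := by
    rw [hT, noise, Matrix.transpose_sub, Matrix.transpose_smul]
  have hF : frobSq (S.Vᵀ * (S.noise ω)ᵀ) = frobSq (S.noise ω * S.V) := by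
    rw [← Matrix.transpose_mul, frobSq_transpose]
  rw [hN, opNorm_transpose, hF] at h0
  refine h0.trans ?_
  have h1 := hG.noise_norm
  have h2 : √(frobSq (S.noise ω * S.V)) ≤ A * (√p * √S.n) := by
    refine Real.sqrt_le_iff.2 ⟨by positivity, hG.right.trans ?_⟩
    rw [mul_pow, mul_pow, Real.sq_sqrt hp.le, Real.sq_sqrt hn.le]
    exact mul_le_mul_of_nonneg_right (by nlinarith) (by positivity)
  have h3 : S.n * L ^ 2 ≤ p * √p * (S.n * √S.d) := by nlinarith
  have h3' : S.d * L ^ 2 ≤ S.n * L ^ 2 := mul_le_mul_of_nonneg_right S.d_le_n_real (sq_nonneg _)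
  have h4 : √((S.n : ℝ) * S.d) * √S.n = S.n * √S.d := by
    rw [Real.sqrt_mul hn.le, mul_right_comm, Real.mul_self_sqrt hn.le]
  have h5 : 2 * p * (c * √((S.n : ℝ) * S.d) * √(frobSq (S.noise ω * S.V))) ≤
      2 * c * A * (p * √p * (S.n * √S.d)) := by
    calc _ ≤ 2 * p * (c * √((S.n : ℝ) * S.d) * (A * (√p * √S.n))) := by gcongr
      _ = 2 * c * A * (p * √p * (√((S.n : ℝ) * S.d) * √S.n)) := by ring
      _ = _ := by rw [h4]
  linarith

/-! ### Spectral gaps of the scaled Gram matrix -/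

lemma antitone_scaled_sq : Antitone fun i => p ^ 2 * S.lam i ^ 2 := fun _ j hij =>
  mul_le_mul_of_nonneg_left (pow_le_pow_left₀ (S.lam_pos j).le (S.lam_antitone hij) 2) (sq_nonneg p)

lemma scaled_sq_eq (i : Fin r) : p ^ 2 * S.lam i ^ 2 = p ^ 2 * (S.n * S.d) * S.b i ^ 2 := by
  rw [S.lam_eq, mul_pow, Real.sq_sqrt (mul_pos S.n_pos S.d_pos).le]; ring

lemma Regular.le_scaled_sq {c α : ℝ} (hreg : S.Regular c α) (hc : 0 < c) (i : Fin r) :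
    p ^ 2 * (S.n * S.d) * (1 / c ^ 2) ≤ p ^ 2 * S.lam i ^ 2 := by
  have hn := S.n_pos
  have hd0 := S.d_pos
  rw [scaled_sq_eq]
  refine mul_le_mul_of_nonneg_left ?_ (by positivity)
  have := pow_le_pow_left₀ (by positivity) (hreg.b_lower i) 2
  rwa [div_pow, one_pow] at this

lemma Regular.gap_scaled_sq {c α δ : ℝ} (hreg : S.Regular c α) (hc : 0 < c) (hδ : 0 < δ)
    (hgap : ∀ i i' : Fin r, i < i' → δ ≤ S.b i - S.b i') {i k : Fin r} (hik : k ≠ i) :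
    p ^ 2 * (S.n * S.d) * (2 * δ / c) ≤ |p ^ 2 * S.lam k ^ 2 - p ^ 2 * S.lam i ^ 2| := by
  have hn := S.n_pos
  have hd0 := S.d_pos
  rw [scaled_sq_eq, scaled_sq_eq, ← mul_sub, abs_mul, abs_of_nonneg (a := p ^ 2 * (S.n * S.d))
    (by positivity)]
  refine mul_le_mul_of_nonneg_left ?_ (by positivity)
  have h1 : δ ≤ |S.b k - S.b i| := by
    rcases lt_or_gt_of_ne hik with h | h
    · exact (hgap k i h).trans (le_abs_self _)
    · rw [abs_sub_comm]; exact (hgap i k h).trans (le_abs_self _)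
  have h2 := hreg.b_lower k
  have h3 := hreg.b_lower i
  have h0 : 0 < 1 / c := by positivity
  rw [sq_sub_sq, abs_mul, abs_of_pos (by linarith)]
  calc 2 * δ / c = (1 / c + 1 / c) * δ := by ring
    _ ≤ _ := mul_le_mul (by linarith) h1 hδ.le (by linarith)

end Model

namespace Spectral

variable {r : ℕ} {p σ L : ℝ} {K : ℝ≥0} {S : Model.{u} r p σ L K} (E : Spectral S)

/-! ### Accuracy of the estimated singular values and vectors -/

lemma tauHat_eq (ω : S.Ω) :
    E.tauHat ω = (∑ j : {j : Fin S.d // r ≤ j.val}, E.evV ω j.1) / ((S.d : ℝ) - r) := by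
  rw [tauHat]
  congr 1
  refine Finset.sum_congr rfl fun j _ => ?_
  have h1 := (E.decompV ω).mulVec_col j.1
  have h2 := col_dotProduct_col (E.decompV ω).orthogonal j.1 j.1
  rw [if_pos rfl] at h2
  have h3 : ((tailCols r (E.VFull ω))ᵀ * S.sigmaHat ω * tailCols r (E.VFull ω)).diag j =
      (fun k => E.VFull ω k j.1) ⬝ᵥ (S.sigmaHat ω *ᵥ fun k => E.VFull ω k j.1) := by
    rw [Matrix.mul_assoc]
    rfl
  rw [h3, h1, dotProduct_smul, h2]; simp

lemma abs_tauHat_le (ω : S.Ω) {e : ℝ} (he : ∀ j : Fin S.d, r ≤ j.val → |E.evV ω j| ≤ e) :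
    |E.tauHat ω| ≤ e := by
  have hpos : (0 : ℝ) < (S.d : ℝ) - r := by
    have : (r : ℝ) < S.d := by exact_mod_cast S.r_lt_d
    linarith
  rw [tauHat_eq, abs_div, abs_of_pos hpos, div_le_iff₀ hpos]
  refine (Finset.abs_sum_le_sum_abs _ _).trans ((Finset.sum_le_sum fun j _ => he j.1 j.2).trans_eq ?_)
  have hcard : Fintype.card {j : Fin S.d // r ≤ j.val} = S.d - r := by
    rw [Fintype.card_subtype]
    have : (Finset.univ.filter fun j : Fin S.d => r ≤ j.val) = Finset.Ici ⟨r, S.r_lt_d⟩ := by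
      ext j; simp [Fin.le_def]
    rw [this, Fin.card_Ici]
  rw [Finset.sum_const, Finset.card_univ, hcard, nsmul_eq_mul, Nat.cast_sub S.r_lt_d.le, mul_comm]

/-- The square root is Lipschitz away from zero; the bound also covers the junk value `√x = 0` for
negative `x`. -/
lemma abs_sqrt_sub_le {x a : ℝ} (ha : 0 < a) : |√x - a| ≤ |x - a ^ 2| / a := by
  rw [le_div_iff₀ ha]
  rcases le_total 0 x with hx | hx
  · have h : x - a ^ 2 = (√x - a) * (√x + a) := by
      linear_combination -(Real.sq_sqrt hx)
    rw [h, abs_mul]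
    refine mul_le_mul_of_nonneg_left ?_ (abs_nonneg _)
    exact le_trans (by linarith [Real.sqrt_nonneg x]) (le_abs_self _)
  · rw [Real.sqrt_eq_zero_of_nonpos hx, zero_sub, abs_neg, abs_of_pos ha]
    exact le_trans (by nlinarith) (neg_le_abs _)

/-- Accuracy of the estimated singular values. -/
lemma abs_lamHat_sub_le {A c α : ℝ} {ω : S.Ω} (hG : S.GoodOutcome A c ω)
    (hreg : S.Regular c α) (hp : 0 < p) (hp1 : p ≤ 1) (hc : 0 < c) (hA : 1 ≤ A)
    (hd : L ^ 2 ≤ p * √p * √S.d) (hd2 : 2 * A ≤ √p * √S.d) (i : Fin r) :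
    |E.lamHat ω i - S.lam i| ≤ (4 * c * (2 * c * A + 5) + 2 * A * c) * √(S.n / p) := by
  have hn := S.n_pos
  have hd0 := S.d_pos
  have hnd := S.sqrt_nd_pos
  have hsp : 0 < √p := Real.sqrt_pos.2 hp
  have hsn : 0 < √(S.n : ℝ) := Real.sqrt_pos.2 hn
  have hsd : 0 < √(S.d : ℝ) := Real.sqrt_pos.2 hd0
  have hspp := Real.mul_self_sqrt hp.le
  have hsnn := Real.mul_self_sqrt hn.le
  have hsqnd : √((S.n : ℝ) * S.d) = √S.n * √S.d := Real.sqrt_mul hn.le _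
  set C := 2 * c * A + 5 with hC
  have hC0 : 0 < C := by positivity
  set e := C * (p * √p * (S.n * √S.d)) with he
  have hnorm := hG.norm_sigmaHat_sub_le hreg hp hp1 hc hA hd
  have hQ := E.decompV ω
  have hlo := hQ.le_ev S.V_orth (Model.antitone_scaled_sq (S := S)) (Fin.castLE S.r_lt_d.le i) i rfl
  have hup := hQ.ev_le S.V_orth (fun i => p ^ 2 * S.lam i ^ 2) (Fin.castLE S.r_lt_d.le i)
    (b := p ^ 2 * S.lam i ^ 2) (by positivity)
    fun k hk => Model.antitone_scaled_sq (S := S) (Fin.le_def.2 hk)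
  have htau : |E.tauHat ω| ≤ e := E.abs_tauHat_le ω fun j hj =>
    (hQ.abs_ev_le S.V_orth (fun _ => by positivity) j hj).trans hnorm
  have hlam := S.lam_pos i
  have hple := hreg.le_lam i
  set x := E.evV ω (Fin.castLE S.r_lt_d.le i) - E.tauHat ω with hx
  have hxa : |x - (p * S.lam i) ^ 2| ≤ 2 * e := by
    rw [abs_le] at htau ⊢
    rw [hx, mul_pow]
    constructor <;> linarith
  have h1 : |√x - p * S.lam i| ≤ 2 * c * C * (√p * √S.n) := by
    refine (abs_sqrt_sub_le (mul_pos hp hlam)).trans ?_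
    rw [div_le_iff₀ (mul_pos hp hlam)]
    refine hxa.trans ?_
    rw [div_le_iff₀ hc, hsqnd] at hple
    calc 2 * e = 2 * C * √p * √S.n * p * (√S.n * √S.d) := by
          rw [he]; nth_rw 1 [← hsnn]; ring
      _ ≤ 2 * C * √p * √S.n * p * (S.lam i * c) := by gcongr
      _ = _ := by ring
  have h2 := hG.proportion
  have hhalf : p / 2 ≤ pHat (S.y ω) := by
    have h3 : A * √p / √((S.n : ℝ) * S.d) ≤ p / 2 := by
      rw [div_le_iff₀ hnd, hsqnd]
      have hn1 : 1 ≤ √(S.n : ℝ) := Real.one_le_sqrt.2 (S.one_le_d.trans S.d_le_n_real)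
      calc A * √p ≤ (√p * √S.d / 2) * √p := by gcongr; linarith
        _ = p / 2 * (1 * √S.d) := by linear_combination (√S.d / 2) * hspp
        _ ≤ _ := by gcongr
    have := (abs_le.1 (h2.trans h3)).1
    linarith
  have hpH : 0 < pHat (S.y ω) := lt_of_lt_of_le (by positivity) hhalf
  have hlamHat : E.lamHat ω i = √x / pHat (S.y ω) := by
    rw [lamHat, Real.sqrt_div' _ (sq_nonneg _), Real.sqrt_sq hpH.le]
  have h4 : |pHat (S.y ω) - p| * S.lam i ≤ A * c * √p := by
    calc |pHat (S.y ω) - p| * S.lam i ≤ (A * √p / √((S.n : ℝ) * S.d)) *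
          (c * √((S.n : ℝ) * S.d)) :=
          mul_le_mul h2 (hreg.lam_le i) hlam.le (by positivity)
      _ = A * c * √p := by field_simp
  have h5 : E.lamHat ω i - S.lam i =
      ((√x - p * S.lam i) - (pHat (S.y ω) - p) * S.lam i) / pHat (S.y ω) := by
    rw [hlamHat]; field_simp; ring
  have h6 : |(√x - p * S.lam i) - (pHat (S.y ω) - p) * S.lam i| ≤
      (2 * c * C + A * c) * (√p * √S.n) := by
    refine (abs_sub _ _).trans ?_
    rw [abs_mul, abs_of_pos hlam]
    have hn1 : 1 ≤ √(S.n : ℝ) := Real.one_le_sqrt.2 (S.one_le_d.trans S.d_le_n_real)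
    have : A * c * √p ≤ A * c * (√p * √S.n) := by
      gcongr; exact le_mul_of_one_le_right hsp.le hn1
    linarith
  rw [h5, abs_div, abs_of_pos hpH, div_le_iff₀ hpH, Real.sqrt_div' _ hp.le]
  refine h6.trans ?_
  calc (2 * c * C + A * c) * (√p * √S.n)
      = (4 * c * C + 2 * A * c) * (√S.n / √p) * (p / 2) := by
        nth_rw 1 [← Real.div_sqrt (x := p)]; ring
    _ ≤ _ := by gcongr

end Spectral

open scoped Matrix.Norms.L2Operator

namespace Spectral

variable {r : ℕ} {p σ L : ℝ} {K : ℝ≥0} {S : Model.{u} r p σ L K} (E : Spectral S)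

/-- Davis–Kahan for a perturbed scaled Gram matrix, with the sizes of perturbation and gap of the
model: the relative error is of order `1 / √(p d)`. -/
lemma dist_sq_le_of_norm_sub_le {m : ℕ} {B Q : Matrix (Fin m) (Fin m) ℝ} {ev : Fin m → ℝ}
    (hQ : IsEigendecomp B Q ev) {W : Matrix (Fin m) (Fin r) ℝ} (hW : Wᵀ * W = 1) {c α δ C : ℝ}
    (hreg : S.Regular c α) (hp : 0 < p) (hc : 0 < c) (hδ : 0 < δ) (hC : 0 < C)
    (hgap : ∀ i i' : Fin r, i < i' → δ ≤ S.b i - S.b i')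
    (hB : ‖B - W * Matrix.diagonal (fun i => p ^ 2 * S.lam i ^ 2) * Wᵀ‖ ≤
      C * (p * √p * (S.n * √S.d)))
    (hd : 2 * C ≤ √p * √S.d * min (2 * δ / c) (1 / c ^ 2)) (i : Fin r) (j : Fin m)
    (hij : j.val = i.val) :
    (((sgn ((fun k => Q k j) ⬝ᵥ fun k => W k i) : ℤ) : ℝ) • (fun k => Q k j) - fun k => W k i) ⬝ᵥ
      (((sgn ((fun k => Q k j) ⬝ᵥ fun k => W k i) : ℤ) : ℝ) • (fun k => Q k j) - fun k => W k i) ≤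
      8 * C ^ 2 / min (2 * δ / c) (1 / c ^ 2) ^ 2 / (p * S.d) := by
  have hn := S.n_pos
  have hd0 := S.d_pos
  have hspp := Real.mul_self_sqrt hp.le
  have hsdd := Real.mul_self_sqrt hd0.le
  have hsp : 0 < √p := Real.sqrt_pos.2 hp
  have hsd : 0 < √(S.d : ℝ) := Real.sqrt_pos.2 hd0
  set γ := min (2 * δ / c) (1 / c ^ 2) with hγ
  have hγ0 : 0 < γ := lt_min (by positivity) (by positivity)
  set g := p ^ 2 * (S.n * S.d) * γ with hg
  have hg0 : 0 < g := by positivity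
  have hgap' : ∀ k, k ≠ i → g ≤ |p ^ 2 * S.lam k ^ 2 - p ^ 2 * S.lam i ^ 2| := fun k hk =>
    (mul_le_mul_of_nonneg_left (min_le_left _ _) (by positivity)).trans
      (hreg.gap_scaled_sq hc hδ hgap hk)
  have hgi : g ≤ p ^ 2 * S.lam i ^ 2 :=
    (mul_le_mul_of_nonneg_left (min_le_right _ _) (by positivity)).trans (hreg.le_scaled_sq hc i)
  have hge : g = p * √p * (S.n * √S.d) * (√p * √S.d * γ) := by
    rw [hg]
    linear_combination (-(p * S.n * √S.d * √S.d * γ)) * hspp - p ^ 2 * S.n * γ * hsdd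
  have he : C * (p * √p * (S.n * √S.d)) ≤ g / 2 := by
    have : 0 < p * √p * (S.n * √S.d) := by positivity
    rw [hge]; nlinarith
  refine (hQ.dist_sq_le hW Model.antitone_scaled_sq (fun _ => by positivity) j i hij hg0 hgap' hgi
    (hB.trans he)).trans ?_
  calc _ ≤ 8 * (C * (p * √p * (S.n * √S.d))) ^ 2 / g ^ 2 := by gcongr
    _ = _ := by
      have h1 : (C * (p * √p * (S.n * √S.d))) ^ 2 = C ^ 2 * (p ^ 2 * p * (S.n ^ 2 * S.d)) := by
        rw [mul_pow, mul_pow, mul_pow, mul_pow, Real.sq_sqrt hp.le, Real.sq_sqrt hd0.le]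
      rw [h1, hg]
      field_simp

lemma frobSq_rank_one_sub_le {n d : ℕ} {u u' : Fin n → ℝ} {v v' : Fin d → ℝ} (hu : u ⬝ᵥ u = 1)
    (hv' : v' ⬝ᵥ v' = 1) (hu' : u' ⬝ᵥ u' = 1) (a b : ℝ) :
    frobSq (a • Matrix.vecMulVec u' v' - b • Matrix.vecMulVec u v) ≤
      3 * ((a - b) ^ 2 + b ^ 2 * ((u' - u) ⬝ᵥ (u' - u)) + b ^ 2 * ((v' - v) ⬝ᵥ (v' - v))) := by
  have h : a • Matrix.vecMulVec u' v' - b • Matrix.vecMulVec u v =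
      (a - b) • Matrix.vecMulVec u' v' + b • Matrix.vecMulVec (u' - u) v' +
        b • Matrix.vecMulVec u (v' - v) := by
    ext k h
    simp only [Matrix.sub_apply, Matrix.add_apply, Matrix.smul_apply, Matrix.vecMulVec_apply,
      Pi.sub_apply, smul_eq_mul]
    ring
  rw [h]
  refine (frobSq_add₃_le _ _ _).trans (le_of_eq ?_)
  simp only [frobSq_smul, frobSq_vecMulVec, hu, hv', hu']
  ring

lemma unit_sq (s : ℤˣ) : ((s : ℤ) : ℝ) ^ 2 = 1 := by
  rcases Int.units_eq_one_or s with h | h <;> simp [h]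

lemma unit_mul_self (s : ℤˣ) : ((s : ℤ) : ℝ) * ((s : ℤ) : ℝ) = 1 := by rw [← sq, unit_sq]

/-- On a good outcome, the estimator with signs `s` is close to the matrix `M₀` with its singular
values multiplied by `s * s₀`. -/
lemma frobSq_MHat_sub_le {A c α δ : ℝ} {ω : S.Ω} (hG : S.GoodOutcome A c ω)
    (hreg : S.Regular c α) (hp : 0 < p) (hp1 : p ≤ 1) (hc : 0 < c) (hA : 1 ≤ A) (hδ : 0 < δ)
    (hgap : ∀ i i' : Fin r, i < i' → δ ≤ S.b i - S.b i')
    (hd : L ^ 2 ≤ p * √p * √S.d) (hd2 : 2 * A ≤ √p * √S.d)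
    (hd3 : 2 * (2 * c * A + 5) ≤ √p * √S.d * min (2 * δ / c) (1 / c ^ 2)) (s : Fin r → ℤˣ) :
    frobSq (E.MHat ω s - (S.M₀ + S.signDiff (s * E.s₀ ω))) ≤
      r * (r * (3 * ((4 * c * (2 * c * A + 5) + 2 * A * c) ^ 2 +
        2 * (c ^ 2 * (8 * (2 * c * A + 5) ^ 2 / min (2 * δ / c) (1 / c ^ 2) ^ 2))))) *
        (S.n / p) := by
  have hn := S.n_pos
  have hd0 := S.d_pos
  set C := 2 * c * A + 5 with hC
  have hC0 : 0 < C := by positivity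
  set γ := min (2 * δ / c) (1 / c ^ 2) with hγ
  set D := 4 * c * C + 2 * A * c with hD
  set κ := 8 * C ^ 2 / γ ^ 2 with hκ
  -- the sign of each singular vector relative to its estimate
  set a : Fin r → ℤˣ := fun i => sgn (E.vHat ω i ⬝ᵥ fun h => S.V h i) with ha
  set b : Fin r → ℤˣ := fun i => sgn (E.uHat ω i ⬝ᵥ fun k => S.U k i) with hb
  have hsum : E.MHat ω s - (S.M₀ + S.signDiff (s * E.s₀ ω)) =
      ∑ i, (((s i * (a i * b i) : ℤˣ) : ℤ) : ℝ) • (E.lamHat ω i • Matrix.vecMulVec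
        (((b i : ℤ) : ℝ) • E.uHat ω i) (((a i : ℤ) : ℝ) • E.vHat ω i) -
        S.lam i • Matrix.vecMulVec (fun k => S.U k i) (fun h => S.V h i)) := by
    have h1 : S.M₀ + S.signDiff (s * E.s₀ ω) = S.withCoeffs fun i =>
        (((s i * (a i * b i) : ℤˣ) : ℤ) : ℝ) * S.lam i := by
      ext k h
      change S.withCoeffs S.lam k h + S.signDiff _ k h = _
      rw [Model.signDiff, Model.withCoeffs_apply, Model.withCoeffs_apply, Model.withCoeffs_apply,
        ← Finset.sum_add_distrib]
      refine Finset.sum_congr rfl fun i _ => ?_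
      have : (s * E.s₀ ω) i = s i * (a i * b i) := rfl
      rw [this]; ring
    rw [h1]
    ext k h
    rw [Matrix.sub_apply, Model.withCoeffs_apply, MHat, Matrix.sum_apply, Matrix.sum_apply,
      ← Finset.sum_sub_distrib]
    refine Finset.sum_congr rfl fun i _ => ?_
    simp only [Matrix.sub_apply, Matrix.smul_apply, Matrix.vecMulVec_apply, Pi.smul_apply,
      smul_eq_mul, Units.val_mul, Int.cast_mul]
    have hA1 := unit_mul_self (a i)
    have hB1 := unit_mul_self (b i)
    linear_combination (-((s i : ℤ) : ℝ) * E.lamHat ω i * (E.uHat ω i k * E.vHat ω i h)) *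
      (((b i : ℤ) : ℝ) * ((b i : ℤ) : ℝ) * hA1 + hB1)
  have hterm : ∀ i, frobSq ((((s i * (a i * b i) : ℤˣ) : ℤ) : ℝ) • (E.lamHat ω i • Matrix.vecMulVec
        (((b i : ℤ) : ℝ) • E.uHat ω i) (((a i : ℤ) : ℝ) • E.vHat ω i) -
        S.lam i • Matrix.vecMulVec (fun k => S.U k i) (fun h => S.V h i))) ≤
      3 * (D ^ 2 + 2 * (c ^ 2 * κ)) * (S.n / p) := by
    intro i
    have hV := dist_sq_le_of_norm_sub_le (E.decompV ω) S.V_orth hreg hp hc hδ hC0 hgap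
      (hG.norm_sigmaHat_sub_le hreg hp hp1 hc hA hd) hd3 i (Fin.castLE S.r_lt_d.le i) rfl
    have hU := dist_sq_le_of_norm_sub_le (E.decompU ω) S.U_orth hreg hp hc hδ hC0 hgap
      (hG.norm_sigmaHatT_sub_le hreg hp hp1 hc hA hd) hd3 i
      (Fin.castLE (S.r_lt_d.le.trans S.d_le_n) i) rfl
    have hu : E.uHat ω i ⬝ᵥ E.uHat ω i = 1 := by
      have := col_dotProduct_col (E.decompU ω).orthogonal
        (Fin.castLE (S.r_lt_d.le.trans S.d_le_n) i) (Fin.castLE (S.r_lt_d.le.trans S.d_le_n) i)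
      rwa [if_pos rfl] at this
    have hv : E.vHat ω i ⬝ᵥ E.vHat ω i = 1 := by
      have := col_dotProduct_col (E.decompV ω).orthogonal
        (Fin.castLE S.r_lt_d.le i) (Fin.castLE S.r_lt_d.le i)
      rwa [if_pos rfl] at this
    have hU1 : (fun k => S.U k i) ⬝ᵥ (fun k => S.U k i) = 1 := by
      have := col_dotProduct_col S.U_orth i i
      rwa [if_pos rfl] at this
    rw [frobSq_smul, unit_sq, one_mul]
    refine (frobSq_rank_one_sub_le hU1
      (by rw [smul_dotProduct, dotProduct_smul, hv, smul_eq_mul, smul_eq_mul, mul_one, unit_mul_self])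
      (by rw [smul_dotProduct, dotProduct_smul, hu, smul_eq_mul, smul_eq_mul, mul_one, unit_mul_self])
      _ _).trans ?_
    have h1 : (E.lamHat ω i - S.lam i) ^ 2 ≤ D ^ 2 * (S.n / p) := by
      have := E.abs_lamHat_sub_le hG hreg hp hp1 hc hA hd hd2 i
      rw [← sq_abs]
      refine (pow_le_pow_left₀ (abs_nonneg _) this 2).trans (le_of_eq ?_)
      rw [mul_pow, Real.sq_sqrt (by positivity)]
    have h2 : S.lam i ^ 2 ≤ c ^ 2 * (S.n * S.d) := by
      refine (pow_le_pow_left₀ (S.lam_pos i).le (hreg.lam_le i) 2).trans (le_of_eq ?_)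
      rw [mul_pow, Real.sq_sqrt (by positivity)]
    have h3 : c ^ 2 * (S.n * S.d) * (κ / (p * S.d)) = c ^ 2 * κ * (S.n / p) := by field_simp
    have h4 := mul_le_mul h2 hU (dotProduct_self_nonneg_real _) (by positivity)
    have h5 := mul_le_mul h2 hV (dotProduct_self_nonneg_real _) (by positivity)
    rw [h3] at h4 h5
    have h4' : S.lam i ^ 2 * ((((b i : ℤ) : ℝ) • E.uHat ω i - fun k => S.U k i) ⬝ᵥ
      (((b i : ℤ) : ℝ) • E.uHat ω i - fun k => S.U k i)) ≤ c ^ 2 * κ * (S.n / p) := h4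
    have h5' : S.lam i ^ 2 * ((((a i : ℤ) : ℝ) • E.vHat ω i - fun k => S.V k i) ⬝ᵥ
      (((a i : ℤ) : ℝ) • E.vHat ω i - fun k => S.V k i)) ≤ c ^ 2 * κ * (S.n / p) := h5
    linarith
  rw [hsum]
  refine (frobSq_sum_le _).trans ?_
  rw [Fintype.card_fin, mul_assoc]
  refine mul_le_mul_of_nonneg_left ((Finset.sum_le_sum fun i _ => hterm i).trans (le_of_eq ?_))
    (Nat.cast_nonneg r)
  simp; ring

/-! ### Recovery of the signs -/

lemma frobSq_add_le {n d : ℕ} (A B : Matrix (Fin n) (Fin d) ℝ) {θ : ℝ} (hθ : 0 < θ) :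
    frobSq (A + B) ≤ (1 + θ) * frobSq A + (1 + 1 / θ) * frobSq B := by
  simp only [frobSq, Finset.mul_sum, ← Finset.sum_add_distrib, Matrix.add_apply]
  refine Finset.sum_le_sum fun k _ => Finset.sum_le_sum fun h _ => ?_
  have h1 : 2 * (A k h * B k h) ≤ θ * A k h ^ 2 + 1 / θ * B k h ^ 2 := by
    have h2 : θ * A k h ^ 2 + 1 / θ * B k h ^ 2 - 2 * (A k h * B k h) =
        (θ * A k h - B k h) ^ 2 / θ := by field_simp; ring
    have h3 : 0 ≤ (θ * A k h - B k h) ^ 2 / θ := by positivity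
    linarith
  nlinarith

lemma le_frobSq_add {n d : ℕ} (A B : Matrix (Fin n) (Fin d) ℝ) {θ : ℝ} (hθ : 0 < θ) :
    (1 - θ) * frobSq A - 1 / θ * frobSq B ≤ frobSq (A + B) := by
  simp only [frobSq, Finset.mul_sum, ← Finset.sum_sub_distrib, Matrix.add_apply]
  refine Finset.sum_le_sum fun k _ => Finset.sum_le_sum fun h _ => ?_
  have h1 : 0 ≤ θ * A k h ^ 2 + 1 / θ * B k h ^ 2 + 2 * (A k h * B k h) := by
    have h2 : θ * A k h ^ 2 + 1 / θ * B k h ^ 2 + 2 * (A k h * B k h) =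
        (θ * A k h + B k h) ^ 2 / θ := by field_simp; ring
    rw [h2]; positivity
  nlinarith [sq_nonneg (B k h)]

lemma frobSq_mask_le (ω : S.Ω) (B : Matrix (Fin S.n) (Fin S.d) ℝ) :
    frobSq (mask (S.y ω) B) ≤ frobSq B := by
  refine Finset.sum_le_sum fun k _ => Finset.sum_le_sum fun h _ => ?_
  simp only [mask, Matrix.of_apply, mul_pow, S.y_sq]
  exact mul_le_of_le_one_left (sq_nonneg _) (S.y_le_one ω k h)

/-- The observed squared error at `s`, in terms of the change of signs `s * s₀`. -/
lemma obj_eq (ω : S.Ω) (s : Fin r → ℤˣ) :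
    E.obj ω s = frobSq (mask (S.y ω) (S.signDiff (s * E.s₀ ω) - S.ε ω) +
      mask (S.y ω) (E.MHat ω s - (S.M₀ + S.signDiff (s * E.s₀ ω)))) := by
  rw [obj]
  congr 1
  ext k h
  simp only [mask, Matrix.sub_apply, Matrix.add_apply, Matrix.of_apply, Model.M]
  have := S.y_sq ω k h
  linear_combination (-(S.M₀ k h + S.ε ω k h)) * this

/-- On a good outcome every minimiser of the observed squared error equals the vector `s₀` of true
signs: a wrong sign costs a multiple of `n d`, while the estimation error only contributes terms of
lower order. The parameter `θ` weighs the two. -/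
lemma eq_s₀_of_isSignEstimator {A c ρ θ : ℝ} {ω : S.Ω} (hG : S.GoodOutcome A c ω)
    (hθ : 0 < θ) (hθ2 : θ ≤ 1 / 2) (hρ : ∀ s, frobSq (E.MHat ω s -
      (S.M₀ + S.signDiff (s * E.s₀ ω))) ≤ ρ) (hp : 0 < p) (hθA : 8 * A * θ ≤ p / c ^ 2)
    (hd : (1 + 2 / θ) * ρ < p / c ^ 2 / 4 * (S.n * S.d)) {s : Fin r → ℤˣ}
    (hs : E.obj ω s ≤ E.obj ω (E.s₀ ω)) : s = E.s₀ ω := by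
  have hn := S.n_pos
  have hd0 := S.d_pos
  by_contra hne
  have hself : E.s₀ ω * E.s₀ ω = 1 := by ext i; simp
  have hne' : s * E.s₀ ω ≠ 1 := fun h => hne (by
    have := congrArg (· * E.s₀ ω) h
    simpa [mul_assoc, hself] using this)
  have hzero : S.signDiff (1 : Fin r → ℤˣ) = 0 := by
    ext k h; rw [Model.signDiff, Model.withCoeffs_apply]; simp
  have hρ1 := fun s => (frobSq_mask_le ω _).trans (hρ s)
  have h1 := le_frobSq_add (mask (S.y ω) (S.signDiff (s * E.s₀ ω) - S.ε ω))
    (mask (S.y ω) (E.MHat ω s - (S.M₀ + S.signDiff (s * E.s₀ ω)))) hθ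
  rw [← obj_eq] at h1
  have h2 := frobSq_add_le (mask (S.y ω) (S.signDiff (E.s₀ ω * E.s₀ ω) - S.ε ω))
    (mask (S.y ω) (E.MHat ω (E.s₀ ω) - (S.M₀ + S.signDiff (E.s₀ ω * E.s₀ ω)))) hθ
  rw [← obj_eq] at h2
  have h3 : frobSq (mask (S.y ω) (S.signDiff (E.s₀ ω * E.s₀ ω) - S.ε ω)) =
      frobSq (mask (S.y ω) (S.ε ω)) := by
    rw [hself, hzero]; simp [frobSq, mask]
  rw [h3] at h2
  have h4 := hG.sign _ hne'
  have h5 := hG.mass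
  set X := frobSq (mask (S.y ω) (S.signDiff (s * E.s₀ ω) - S.ε ω))
  set Y := frobSq (mask (S.y ω) (S.ε ω))
  set a := p / c ^ 2
  set q := (S.n : ℝ) * S.d
  have hq : 0 < q := mul_pos hn hd0
  have h6 : 1 / θ * frobSq (mask (S.y ω) (E.MHat ω s - (S.M₀ + S.signDiff (s * E.s₀ ω)))) ≤
      1 / θ * ρ := mul_le_mul_of_nonneg_left (hρ1 s) (by positivity)
  have h7 : (1 + 1 / θ) * frobSq (mask (S.y ω) (E.MHat ω (E.s₀ ω) -
      (S.M₀ + S.signDiff (E.s₀ ω * E.s₀ ω)))) ≤ (1 + 1 / θ) * ρ :=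
    mul_le_mul_of_nonneg_left (hρ1 _) (by positivity)
  have h8 : (1 - θ) * (Y + a * q) ≤ (1 - θ) * X :=
    mul_le_mul_of_nonneg_left (by linarith) (by linarith)
  have h9 : 2 * θ * Y ≤ 2 * θ * (A * q) := mul_le_mul_of_nonneg_left h5 (by linarith)
  have h10 : 8 * A * θ * q ≤ a * q := mul_le_mul_of_nonneg_right hθA hq.le
  have h0 : 0 ≤ a := by positivity
  have h11 : θ * (a * q) ≤ 1 / 2 * (a * q) := mul_le_mul_of_nonneg_right hθ2 (by positivity)
  have h12 : (1 + 2 / θ) * ρ = 1 / θ * ρ + (1 + 1 / θ) * ρ := by ring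
  linarith

end Spectral

/-! ### The error bound -/

section ErrorBound

variable {r : ℕ} {p σ L c α δ : ℝ} {K : ℝ≥0}

attribute [local instance] Model.mΩ Model.isProb

/-- The error bound for one model, in probability, as soon as the smaller dimension is large. -/
lemma exists_eventually_measure_sqError_le (i₀ : Fin r) (σ α : ℝ) (K : ℝ≥0) (hL : 0 < L)
    (hc : 0 < c) (hδ : 0 < δ) {η : ℝ} (hη : 0 < η) :
    ∃ C : ℝ, 0 < C ∧ ∀ p : ℝ, 0 < p → p ≤ 1 → ∀ᶠ d : ℕ in atTop,
      ∀ (S : Model.{u} r p σ L K) (E : Spectral S) (sHat : S.Ω → Fin r → ℤˣ), S.d = d →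
        S.Regular c α → (∀ i i' : Fin r, i < i' → δ ≤ S.b i - S.b i') → E.IsSignEstimator sHat →
        S.μ {ω | C ≤ p * S.b i₀ ^ 4 / (S.n : ℝ) * E.sqError sHat ω} ≤
          ENNReal.ofReal η := by
  obtain ⟨A, hA, hgood⟩ := Model.exists_eventually_measure_not_goodOutcome_le.{u} r σ L c α K hL hc hη
  set γ := min (2 * δ / c) (1 / c ^ 2) with hγ
  have hγ0 : 0 < γ := lt_min (by positivity) (by positivity)
  set R := r * (r * (3 * ((4 * c * (2 * c * A + 5) + 2 * A * c) ^ 2 +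
    2 * (c ^ 2 * (8 * (2 * c * A + 5) ^ 2 / γ ^ 2))))) with hR
  have hR0 : 0 ≤ R := by positivity
  refine ⟨c ^ 4 * R + 1, by positivity, fun p hp hp1 => ?_⟩
  have hsp : 0 < √p := Real.sqrt_pos.2 hp
  have hA0 : 0 < A := zero_lt_one.trans_le hA
  set θ := min (1 / 2) (p / c ^ 2 / (8 * A)) with hθ
  have hθ0 : 0 < θ := lt_min (by norm_num) (by positivity)
  have hθA : 8 * A * θ ≤ p / c ^ 2 := by
    have := min_le_right (1 / 2) (p / c ^ 2 / (8 * A))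
    rw [← hθ, le_div_iff₀ (by positivity)] at this
    linarith
  have hsqrt : Tendsto (fun d : ℕ => √(d : ℝ)) atTop atTop :=
    Real.tendsto_sqrt_atTop.comp tendsto_natCast_atTop_atTop
  have hnat : Tendsto (fun d : ℕ => (d : ℝ)) atTop atTop := tendsto_natCast_atTop_atTop
  filter_upwards [hgood p hp hp1, hsqrt.eventually_ge_atTop (L ^ 2 / (p * √p)),
    hsqrt.eventually_ge_atTop (2 * A / √p),
    hsqrt.eventually_ge_atTop (2 * (2 * c * A + 5) / (√p * γ)),
    hnat.eventually_gt_atTop ((1 + 2 / θ) * R / (p * (p / c ^ 2 / 4)))]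
    with d h1 h2 h3 h4 h5 S E sHat hS hreg hgap hsign
  rw [← hS] at h2 h3 h4 h5
  have hn := S.n_pos
  have hd0 := S.d_pos
  rw [div_le_iff₀ (by positivity)] at h2 h3 h4
  rw [div_lt_iff₀ (by positivity)] at h5
  refine (measure_mono fun ω hω => ?_).trans (h1 S hS hreg)
  by_contra hcon
  have hG : S.GoodOutcome A c ω := by
    by_contra h; exact hcon h
  have hbound := E.frobSq_MHat_sub_le hG hreg hp hp1 hc hA hδ hgap (by linarith) (by linarith)
    (by linarith)
  have hs : sHat ω = E.s₀ ω := by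
    refine E.eq_s₀_of_isSignEstimator hG hθ0 (min_le_left _ _) hbound hp hθA ?_ (hsign ω _)
    calc (1 + 2 / θ) * (R * (S.n / p)) = (1 + 2 / θ) * R * S.n / p := by ring
      _ < S.d * (p * (p / c ^ 2 / 4)) * S.n / p := by gcongr
      _ = _ := by field_simp
  have herr : E.sqError sHat ω ≤ R * (S.n / p) := by
    have h6 := hbound (E.s₀ ω)
    have hself : E.s₀ ω * E.s₀ ω = 1 := by ext i; simp
    have hzero : S.signDiff (1 : Fin r → ℤˣ) = 0 := by
      ext k h; rw [Model.signDiff, Model.withCoeffs_apply]; simp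
    rw [hself, hzero, add_zero] at h6
    rwa [Spectral.sqError, hs]
  have hb : S.b i₀ ^ 4 ≤ c ^ 4 :=
    pow_le_pow_left₀ ((by positivity : (0 : ℝ) ≤ 1 / c).trans (hreg.b_lower _)) (hreg.b_upper _) 4
  have hω' : c ^ 4 * R + 1 ≤ p * S.b i₀ ^ 4 / (S.n : ℝ) * E.sqError sHat ω := hω
  have herr0 : 0 ≤ E.sqError sHat ω := frobSq_nonneg _
  have hfin : p * S.b i₀ ^ 4 / (S.n : ℝ) * E.sqError sHat ω ≤ c ^ 4 * R := by
    calc _ ≤ p * c ^ 4 / (S.n : ℝ) * (R * (S.n / p)) := by gcongr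
      _ = _ := by field_simp
  linarith

/-- Since `n ≤ exp (d ^ α)` with `α < 1`, the smaller dimension tends to infinity with `n`. -/
lemma Setting.tendsto_d {S : ℕ → Model.{u} r p σ L K} {E : ∀ j, Spectral (S j)}
    {sHat : ∀ j, (S j).Ω → Fin r → ℤˣ} (hα : α < 1) (h : Setting c α δ S E sHat) :
    Tendsto (fun j => (S j).d) atTop atTop := by
  refine tendsto_atTop.2 fun D => ?_
  have hn := h.n_tendsto.eventually_gt_atTop ⌊Real.exp D⌋₊
  filter_upwards [hn] with j hj
  have h1 : Real.exp D < (S j).n := Nat.lt_of_floor_lt hj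
  have h2 := (h.regular j).n_le
  have h3 : (D : ℝ) < ((S j).d : ℝ) ^ α := Real.exp_lt_exp.1 (h1.trans_le h2)
  have h4 : ((S j).d : ℝ) ^ α ≤ (S j).d := by
    calc ((S j).d : ℝ) ^ α ≤ ((S j).d : ℝ) ^ (1 : ℝ) :=
          Real.rpow_le_rpow_of_exponent_le (S j).one_le_d hα.le
      _ = _ := Real.rpow_one _
  exact_mod_cast (h3.trans_le h4).le

end ErrorBound

end MatrixCompletion

theorem theorem4 (r : ℕ) (hr : 0 < r) (σ L c α δ : ℝ) (K : ℝ≥0)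
    (hL : 0 < L) (hc : 0 < c) (hα : α < 1) (hδ : 0 < δ) :
    (∀ η : ℝ, 0 < η → ∃ C : ℝ, 0 < C ∧
      ∀ p : ℝ, 0 < p → p ≤ 1 →
      ∀ (S : ℕ → MatrixCompletion.Model.{u} r p σ L K)
        (E : ∀ j, MatrixCompletion.Spectral (S j))
        (sHat : ∀ j, (S j).Ω → Fin r → ℤˣ),
        MatrixCompletion.Setting c α δ S E sHat →
        ∀ᶠ j in atTop,
          (S j).μ {ω | C ≤ p * (S j).b ⟨r - 1, by omega⟩ ^ 4 / ((S j).n : ℝ) *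
            (E j).sqError (sHat j) ω} ≤ ENNReal.ofReal η) ∧
    (∀ p : ℝ, 0 < p → p ≤ 1 →
      ∀ (S : ℕ → MatrixCompletion.Model.{u} r p σ L K)
        (E : ∀ j, MatrixCompletion.Spectral (S j))
        (sHat : ∀ j, (S j).Ω → Fin r → ℤˣ),
        MatrixCompletion.Setting c α δ S E sHat →
        ∀ h : ℕ → ℝ, Tendsto h atTop atTop →
        ∀ ξ : ℝ, 0 < ξ →
          Tendsto (fun j => (S j).μ {ω | ξ ≤ p * (S j).b ⟨r - 1, by omega⟩ ^ 4 /
            (h j * ((S j).n : ℝ)) * (E j).sqError (sHat j) ω}) atTop (𝓝 0)) := by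
  have hmain : ∀ η : ℝ, 0 < η → ∃ C : ℝ, 0 < C ∧
      ∀ p : ℝ, 0 < p → p ≤ 1 →
      ∀ (S : ℕ → MatrixCompletion.Model.{u} r p σ L K)
        (E : ∀ j, MatrixCompletion.Spectral (S j))
        (sHat : ∀ j, (S j).Ω → Fin r → ℤˣ),
        MatrixCompletion.Setting c α δ S E sHat →
        ∀ᶠ j in atTop,
          (S j).μ {ω | C ≤ p * (S j).b ⟨r - 1, by omega⟩ ^ 4 / ((S j).n : ℝ) *
            (E j).sqError (sHat j) ω} ≤ ENNReal.ofReal η := by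
    intro η hη
    obtain ⟨C, hC, hbound⟩ :=
      MatrixCompletion.exists_eventually_measure_sqError_le.{u}
        (⟨r - 1, Nat.sub_one_lt hr.ne'⟩ : Fin r) σ α K hL hc hδ hη
    refine ⟨C, hC, fun p hp hp1 S E sHat hS => ?_⟩
    filter_upwards [(hS.tendsto_d hα).eventually (hbound p hp hp1)] with j hj
    exact hj (S j) (E j) (sHat j) rfl (hS.regular j) (hS.gap j) (hS.sHat_spec j)
  refine ⟨hmain, fun p hp hp1 S E sHat hS h hh ξ hξ => ?_⟩
  refine ENNReal.tendsto_nhds_zero.2 fun ε hε => ?_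
  -- a positive real number below `ε`, which may be infinite
  obtain ⟨η, hη, hηε⟩ : ∃ η : ℝ, 0 < η ∧ ENNReal.ofReal η ≤ ε := by
    obtain ⟨x, hx0, hx⟩ := ENNReal.lt_iff_exists_nnreal_btwn.1 hε
    exact ⟨x, by exact_mod_cast hx0, by rw [ENNReal.ofReal_coe_nnreal]; exact hx.le⟩
  obtain ⟨C, hC, hbound⟩ := hmain η hη
  filter_upwards [hbound p hp hp1 S E sHat hS, hh.eventually_ge_atTop (C / ξ),
    hh.eventually_gt_atTop 0] with j hj hjC hj0
  refine (measure_mono fun ω hω => ?_).trans (hj.trans hηε)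
  simp only [Set.mem_ofPred_eq] at hω ⊢
  rw [div_le_iff₀ hξ] at hjC
  have hn := (S j).n_pos
  calc C ≤ h j * ξ := hjC
    _ ≤ h j * (p * (S j).b ⟨r - 1, by omega⟩ ^ 4 / (h j * ((S j).n : ℝ)) *
        (E j).sqError (sHat j) ω) := mul_le_mul_of_nonneg_left hω hj0.le
    _ = _ := by field_simp
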